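/- Let $\Omega\subset\mathbb R^3$ be open, with Cartesian coordinates $(x,y,z)$ and cylindrical coordinates $\rho=\sqrt{x^2+y^2}$, $\varphi$, $\zeta=z$, and let $U,a,k,\mu$ be functions of $(\rho,\zeta)$, regarded as functions on $\Omega$. Suppose they describe a stationary, axially symmetric, rigidly rotating dust in co-moving canonical Weyl coordinates. That is, $\mu\ge 0$ is continuous on $\Omega$, and at the points of $\Omega$ off the axis $\rho=0$ the metric $$ds^2=e^{-2U}\big[e^{2k}(d\rho^2+d\zeta^2)+\rho^2d\varphi^2\big]-e^{2U}(dt+a\,d\varphi)^2$$ satisfies Einstein's equations $G_{ab}=8\pi T_{ab}$ (units $c=G=1$), where the only non-vanishing component of the stress-energy tensor is $T^{tt}=\mu e^{-2U}$. Assume moreover: 1. $\partial\Omega$ is continuously differentiable, $\mu\neq0$ everywhere in $\Omega$, and $U,a,k\in C^2(\Omega)$. 2. The origin belongs to $\Omega$, and the spacetime is elementarily flat: at every point of the axis in $\Omega$, the squared norm $X=g_{\varphi\varphi}$ of the axial Killing vector tends to $0$ and $g^{ab}X_{,a}X_{,b}/(4X)$ tends to $1$. **(i)** If $\mu$ equals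 a constant $\mu_0\ne0$ on the part of the axis $\rho=0$ lying in $\Omega$, then there are $\sigma>0$ with $B_\sigma\subset\Omega$ (the open ball of radius $\sigma$ about the origin) and a constant $U_0$ such that on $B_\sigma$: - $U=U_0$. - There is a potential $b\in C^2(B_\sigma)$, a function of $(\rho,\zeta)$, with $b_{,\rho}=-\frac{a_{,\zeta}}{\rho}e^{4U}$ and $b_{,\zeta}=\frac{a_{,\rho}}{\rho}e^{4U}$ off the axis. With one and the same sign for all such potentials, each of them is $$b(\rho,\zeta)=b(0,0)\pm\sqrt{8\pi e^{2U_0}\mu_0}\;\zeta .$$ - $k=-\pi\mu_0e^{-2U_0}\rho^2$. - $\mu=\mu_0\exp\!\big(2\pi\mu_0e^{-2U_0}\rho^2\big)$ (the Lanczos density). **(ii)** Under assumptions 1 and 2 the mass density $\mu$ is not constant on $\Omega$, i.e. such a dust configuration is never homogeneous. -/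

import Mathlib

open scoped Topology

noncomputable section

namespace Dust

/-! ### Spacetime tensors in a coordinate chart

Points of the chart are `p : Fin 4 → ℝ`; a metric is given by its component matrix `g p`. -/

/-- Partial derivative `∂f/∂pⁱ`. -/
def pderiv (i : Fin 4) (f : (Fin 4 → ℝ) → ℝ) (p : Fin 4 → ℝ) : ℝ :=
  deriv (fun s : ℝ => f (Function.update p i s)) (p i)

/-- Christoffel symbols `Γ^c_{ab}` of the Levi-Civita connection. -/
def christoffel (g : (Fin 4 → ℝ) → Matrix (Fin 4) (Fin 4) ℝ) (c a b : Fin 4)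
    (p : Fin 4 → ℝ) : ℝ :=
  (1 / 2) * ∑ d, (g p)⁻¹ c d *
    (pderiv a (fun q => g q d b) p + pderiv b (fun q => g q d a) p
      - pderiv d (fun q => g q a b) p)

/-- Ricci tensor
`R_{ab} = ∂_c Γ^c_{ab} - ∂_b Γ^c_{ac} + Γ^c_{cd} Γ^d_{ab} - Γ^c_{bd} Γ^d_{ac}`. -/
def ricci (g : (Fin 4 → ℝ) → Matrix (Fin 4) (Fin 4) ℝ) (a b : Fin 4) (p : Fin 4 → ℝ) : ℝ :=
  ∑ c, (pderiv c (christoffel g c a b) p - pderiv b (christoffel g c a c) p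
    + ∑ d, (christoffel g c c d p * christoffel g d a b p
      - christoffel g c b d p * christoffel g d a c p))

/-- Scalar curvature `R = g^{ab} R_{ab}`. -/
def scalarCurvature (g : (Fin 4 → ℝ) → Matrix (Fin 4) (Fin 4) ℝ) (p : Fin 4 → ℝ) : ℝ :=
  ∑ a, ∑ b, (g p)⁻¹ a b * ricci g a b p

/-- Einstein tensor `G_{ab} = R_{ab} - (1/2) R g_{ab}`. -/
def einstein (g : (Fin 4 → ℝ) → Matrix (Fin 4) (Fin 4) ℝ) (a b : Fin 4) (p : Fin 4 → ℝ) : ℝ :=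
  ricci g a b p - (1 / 2) * scalarCurvature g p * g p a b

/-- Einstein's field equations `G_{ab} = 8π T_{ab}` at `p` (units `c = G = 1`), where the
stress-energy tensor is given by its contravariant components `T^{cd}`. -/
def EinsteinEquationsAt (g T : (Fin 4 → ℝ) → Matrix (Fin 4) (Fin 4) ℝ) (p : Fin 4 → ℝ) : Prop :=
  ∀ a b, einstein g a b p
    = 8 * Real.pi * ∑ c, ∑ d, g p a c * g p b d * T p c d

/-! ### The Lewis-Papapetrou metric in co-moving canonical Weyl coordinates -/

/-- The line element
`e^{-2U} [e^{2k} (dρ² + dζ²) + ρ² dφ²] - e^{2U} (dt + a dφ)²`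
in the coordinates `p = (t, ρ, ζ, φ)`; the functions `U a k` take the arguments `ρ ζ`. -/
def weylMetric (U a k : ℝ → ℝ → ℝ) (p : Fin 4 → ℝ) : Matrix (Fin 4) (Fin 4) ℝ :=
  let u := U (p 1) (p 2)
  let A := a (p 1) (p 2)
  let K := k (p 1) (p 2)
  !![-Real.exp (2 * u), 0, 0, -(Real.exp (2 * u) * A);
     0, Real.exp (-2 * u) * Real.exp (2 * K), 0, 0;
     0, 0, Real.exp (-2 * u) * Real.exp (2 * K), 0;
     -(Real.exp (2 * u) * A), 0, 0,
       Real.exp (-2 * u) * p 1 ^ 2 - Real.exp (2 * u) * A ^ 2]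

/-- Stress-energy tensor of dust at rest: the only nonzero component is `T^{tt} = μ e^{-2U}`. -/
def dustStress (U μ : ℝ → ℝ → ℝ) (p : Fin 4 → ℝ) : Matrix (Fin 4) (Fin 4) ℝ :=
  fun c d => if c = 0 ∧ d = 0 then μ (p 1) (p 2) * Real.exp (-2 * U (p 1) (p 2)) else 0

/-- Three-dimensional Euclidean space with Cartesian coordinates `x = (x 0, x 1, x 2)`; the axis of
rotation is the line `x 0 = x 1 = 0`. -/
abbrev Space : Type := EuclideanSpace ℝ (Fin 3)

/-- The cylindrical radius `ρ`. -/
def rho (x : Space) : ℝ := Real.sqrt (x 0 ^ 2 + x 1 ^ 2)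

/-- The axial coordinate `ζ`. -/
def zeta (x : Space) : ℝ := x 2

/-- The axially symmetric function on `ℝ³` given by a function of `ρ` and `ζ`. -/
def axial (f : ℝ → ℝ → ℝ) (x : Space) : ℝ := f (rho x) (zeta x)

/-- The point of `ℝ³` with cylindrical coordinates `ρ = p 1`, `ζ = p 2`, `φ = p 3`. -/
def place (p : Fin 4 → ℝ) : Space := !₂[p 1 * Real.cos (p 3), p 1 * Real.sin (p 3), p 2]

/-- The part of the axis of rotation in `Ω`. -/
def axisIn (Ω : Set Space) : Set Space := {x ∈ Ω | rho x = 0}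

/-- The functions `U, a, k, μ` describe a stationary, axially symmetric, rigidly rotating dust in
the open set `Ω`: Einstein's equations with the dust source hold wherever the coordinates
`(t, ρ, ζ, φ)` are regular, i.e. off the axis, and are carried over to the axis by continuity
of `μ`. -/
structure IsRigidlyRotatingDust (Ω : Set Space) (U a k μ : ℝ → ℝ → ℝ) : Prop where
  isOpen : IsOpen Ω
  density_nonneg : ∀ x ∈ Ω, 0 ≤ axial μ x
  density_continuous : ContinuousOn (axial μ) Ω
  einstein_eq : ∀ p : Fin 4 → ℝ, 0 < p 1 → place p ∈ Ω →
    EinsteinEquationsAt (weylMetric U a k) (dustStress U μ) p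

/-- The boundary of `Ω` is a continuously differentiable surface. -/
def HasC1Boundary (Ω : Set Space) : Prop :=
  ∀ x ∈ frontier Ω, ∃ V : Set Space, IsOpen V ∧ x ∈ V ∧ ∃ f : Space → ℝ,
    ContDiffOn ℝ 1 f V ∧ fderiv ℝ f x ≠ 0 ∧ frontier Ω ∩ V = {y ∈ V | f y = 0}

/-- Regularity assumptions: `C¹` boundary, nowhere vanishing density, and `U, a, k ∈ C²(Ω)`
as functions on the subset `Ω` of `ℝ³`. -/
structure RegularityAssumptions (Ω : Set Space) (U a k μ : ℝ → ℝ → ℝ) : Prop where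
  boundary : HasC1Boundary Ω
  density_ne_zero : ∀ x ∈ Ω, axial μ x ≠ 0
  contDiff_U : ContDiffOn ℝ 2 (axial U) Ω
  contDiff_a : ContDiffOn ℝ 2 (axial a) Ω
  contDiff_k : ContDiffOn ℝ 2 (axial k) Ω

/-- Squared norm `X = g_{φφ}` of the axial Killing vector `∂_φ`. -/
def axialNorm (g : (Fin 4 → ℝ) → Matrix (Fin 4) (Fin 4) ℝ) (p : Fin 4 → ℝ) : ℝ := g p 3 3

/-- The squared gradient `g^{ab} X_{,a} X_{,b}` of a scalar `X`. -/
def gradSq (g : (Fin 4 → ℝ) → Matrix (Fin 4) (Fin 4) ℝ) (X : (Fin 4 → ℝ) → ℝ)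
    (p : Fin 4 → ℝ) : ℝ :=
  ∑ a, ∑ b, (g p)⁻¹ a b * pderiv a X p * pderiv b X p

/-- Elementary flatness at the axis: at every axis point of `Ω`, the squared norm `X` of the
axial Killing vector tends to `0` and `g^{ab} X_{,a} X_{,b} / (4 X)` tends to `1`, so that
small circles around the axis have the ratio `2π` of circumference and radius. -/
def ElementarilyFlat (Ω : Set Space) (g : (Fin 4 → ℝ) → Matrix (Fin 4) (Fin 4) ℝ) : Prop :=
  ∀ x ∈ axisIn Ω, ∀ t φ : ℝ,
    Filter.Tendsto (fun q : ℝ × ℝ => axialNorm g ![t, q.1, q.2, φ])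
      (𝓝[>] 0 ×ˢ 𝓝 (zeta x)) (𝓝 0) ∧
    Filter.Tendsto (fun q : ℝ × ℝ =>
        gradSq g (axialNorm g) ![t, q.1, q.2, φ] / (4 * axialNorm g ![t, q.1, q.2, φ]))
      (𝓝[>] 0 ×ˢ 𝓝 (zeta x)) (𝓝 1)

/-- Axis assumptions: the origin lies on the part of the axis in `Ω` (which is then nonempty),
and the spacetime is elementarily flat. -/
structure AxisAssumptions (Ω : Set Space) (U a k : ℝ → ℝ → ℝ) : Prop where
  origin_mem : (0 : Space) ∈ axisIn Ω
  flat : ElementarilyFlat Ω (weylMetric U a k)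

/-- `b ∈ C²(S)` is a potential for `a` on `S`:
`b_{,ρ} = -(a_{,ζ} / ρ) e^{4U}` and `b_{,ζ} = (a_{,ρ} / ρ) e^{4U}` off the axis. -/
structure IsPotential (S : Set Space) (U a b : ℝ → ℝ → ℝ) : Prop where
  contDiff : ContDiffOn ℝ 2 (axial b) S
  deriv_rho : ∀ x ∈ S, 0 < rho x →
    deriv (fun r => b r (zeta x)) (rho x)
      = -(deriv (fun z => a (rho x) z) (zeta x) / rho x) * Real.exp (4 * axial U x)
  deriv_zeta : ∀ x ∈ S, 0 < rho x →
    deriv (fun z => b (rho x) z) (zeta x)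
      = deriv (fun r => a r (zeta x)) (rho x) / rho x * Real.exp (4 * axial U x)

end Dust

end

open scoped Topology

noncomputable section

namespace Dust

/-! ### Parametric integrals -/

/-! Off the axis, Einstein's equations give `k_ρ` and `k_ζ` in terms of the gradients of `U` and
`a`, and second-order equations for `U`, `a` and `k`. These are overdetermined: equality of the
mixed derivatives of `k`, and the prescribed value of `k_ρρ + k_ζζ`, force `μ ∇U = 0`. This is the
Bianchi identity, i.e. the dust particles are in free fall. Since `μ ≠ 0`, `U` is a constant `U₀`
near the origin (`gradient_eq_zero_of_density_ne_zero`, `const_U_of_dust`).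

What remains is the linear equation `a_ρρ - a_ρ/ρ + a_ζζ = 0`, while `k` and `μ` are computed from
`∇a`. Elementary flatness yields `a = 0` and `k = 0` on the axis, and the limit of the density
equation there is `a_ρρ² = 8π μ e^{-6U₀}` (`sq_stream_axis`). If `μ = μ₀` on the axis, then `a_ρρ`
is continuous with constant nonzero square, hence a constant `κ`. Now `a - κρ²/2` solves the same
equation with vanishing axis data, so it is zero (`stream_eq_of_axis`). Inserting `a = κρ²/2` gives
`k`, `μ` and the linear potential `b`, whose sign is the sign of `κ`. The resulting density varies
with `ρ`, so a constant density is impossible.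

The analytic core is uniqueness for the stream equation, which is singular on the axis
(`eq_zero_of_stream_equation`). The equation says that `-(f_z/x) dx + (f_x/x) dz` is closed; let `h`
be its primitive. The Abel-type transforms of `f/x` and of `x h` over `x = s sin θ` satisfy the
Cauchy-Riemann equations in `(s, z)` and vanish for `s = 0`. By the identity theorem they vanish
identically, and injectivity of the transform (`eq_zero_of_abel_eq_zero`) gives `f = 0`. -/

theorem continuousOn_parametric_integral {X : Type*} [TopologicalSpace X] {S : Set X}
    {Φ : X → ℝ → ℝ} {a b : ℝ}
    (hΦ : ContinuousOn (fun q : X × ℝ => Φ q.1 q.2) (S ×ˢ Set.uIcc a b)) :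
    ContinuousOn (fun q => ∫ θ in a..b, Φ q θ) S := by
  have hab : min a b ≤ max a b := min_le_max
  -- Clamping `θ` to the interval makes the integrand continuous on all of `S × ℝ` without changing
  -- the integral.
  have key : Continuous (fun q : S => ∫ θ in a..b,
      Φ q (Set.projIcc (min a b) (max a b) hab θ)) := by
    apply intervalIntegral.continuous_parametric_intervalIntegral_of_continuous'
    rw [← continuousOn_univ]
    refine hΦ.comp (f := fun p : S × ℝ => ((p.1 : X),
      ((Set.projIcc (min a b) (max a b) hab p.2 : Set.Icc (min a b) (max a b)) : ℝ))) ?_ ?_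
    · exact (by fun_prop : Continuous _).continuousOn
    · rintro ⟨p, θ⟩ -
      exact ⟨p.2, (Set.projIcc (min a b) (max a b) hab θ).2⟩
  rw [continuousOn_iff_continuous_domRestrict]
  convert! key using 1
  ext q
  refine intervalIntegral.integral_congr fun θ hθ => ?_
  simp only [Set.projIcc_of_mem hab hθ]

theorem hasDerivAt_parametric_integral {Φ Φ' : ℝ → ℝ → ℝ} {U : Set ℝ} (hU : IsOpen U) {a b : ℝ}
    (hΦ : ∀ s ∈ U, ContinuousOn (Φ s) (Set.uIcc a b))
    (hΦ' : ContinuousOn (fun q : ℝ × ℝ => Φ' q.1 q.2) (U ×ˢ Set.uIcc a b))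
    (hd : ∀ s ∈ U, ∀ θ ∈ Set.uIcc a b, HasDerivAt (fun s => Φ s θ) (Φ' s θ) s)
    {s : ℝ} (hs : s ∈ U) :
    HasDerivAt (fun s => ∫ θ in a..b, Φ s θ) (∫ θ in a..b, Φ' s θ) s := by
  obtain ⟨ε, hε, hεU⟩ := Metric.nhds_basis_closedBall.mem_iff.1 (hU.mem_nhds hs)
  obtain ⟨C, hC⟩ := ((isCompact_closedBall s ε).prod
    (isCompact_uIcc (a := a) (b := b))).exists_bound_of_continuousOn
    (hΦ'.mono (Set.prod_mono hεU subset_rfl))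
  have hsub : Set.uIoc a b ⊆ Set.uIcc a b := Set.uIoc_subset_uIcc
  refine (intervalIntegral.hasDerivAt_integral_of_dominated_loc_of_deriv_le
    (bound := fun _ => C) (Metric.closedBall_mem_nhds s hε) ?_ (hΦ s hs).intervalIntegrable ?_ ?_
    intervalIntegrable_const ?_).2
  · filter_upwards [hU.mem_nhds hs] with x hx
    exact ((hΦ x hx).mono hsub).aestronglyMeasurable measurableSet_uIoc
  · refine ContinuousOn.aestronglyMeasurable ?_ measurableSet_uIoc
    exact hΦ'.comp (f := fun θ => (s, θ)) (by fun_prop) fun θ hθ => ⟨hs, hsub hθ⟩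
  · exact Filter.Eventually.of_forall fun θ hθ x hx => hC (x, θ) ⟨hx, hsub hθ⟩
  · exact Filter.Eventually.of_forall fun θ hθ x hx => hd x (hεU hx) θ (hsub hθ)

/-! ### The Abel transform in angular form -/

/-- Wallis: by the reduction formula, `n + 1` times this product does not depend on `n`. It is the
monomial case of the Abel double integral. -/
theorem integral_sin_pow_mul_integral_sin_pow_succ (n : ℕ) :
    (∫ x in (0 : ℝ)..Real.pi, Real.sin x ^ n) * (∫ x in (0 : ℝ)..Real.pi, Real.sin x ^ (n + 1))
      = 2 * Real.pi / (n + 1) := by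
  induction n with
  | zero => simp [integral_sin]; ring
  | succ n ih =>
    rw [integral_sin_pow, mul_add]
    simp only [Real.sin_zero, Real.sin_pi, zero_pow (Nat.succ_ne_zero n), zero_mul, sub_zero,
      zero_div, mul_zero, zero_add]
    have h1 : ((n : ℝ) + 1) ≠ 0 := by positivity
    have h2 : ((n : ℝ) + 2) ≠ 0 := by positivity
    rw [mul_left_comm, mul_comm (∫ x in (0 : ℝ)..Real.pi, Real.sin x ^ (n + 1)), ih]
    push_cast
    field_simp
    ring

theorem continuous_sin_mul_integral {f : ℝ → ℝ} (hf : Continuous f) :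
    Continuous fun ψ : ℝ => Real.sin ψ * ∫ θ in (0 : ℝ)..Real.pi,
      f (Real.sin ψ * Real.sin θ) := by
  refine Real.continuous_sin.mul
    (intervalIntegral.continuous_parametric_intervalIntegral_of_continuous'
      (f := fun ψ θ : ℝ => f (Real.sin ψ * Real.sin θ)) ?_ _ _)
  exact hf.comp (by fun_prop : Continuous fun q : ℝ × ℝ => Real.sin q.1 * Real.sin q.2)

theorem abel_double_integral_polynomial (p : Polynomial ℝ) :
    ∫ ψ in (0 : ℝ)..Real.pi, Real.sin ψ * ∫ θ in (0 : ℝ)..Real.pi,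
        p.eval (Real.sin ψ * Real.sin θ)
      = 2 * Real.pi * ∫ x in (0 : ℝ)..1, p.eval x := by
  induction p using Polynomial.induction_on' with
  | add p q hp hq =>
    have c1 : ∀ r : Polynomial ℝ, Continuous fun y : ℝ => r.eval y := fun r => r.continuous
    have h1 : ∀ ψ, ∫ θ in (0 : ℝ)..Real.pi, (p + q).eval (Real.sin ψ * Real.sin θ)
        = (∫ θ in (0 : ℝ)..Real.pi, p.eval (Real.sin ψ * Real.sin θ))
          + ∫ θ in (0 : ℝ)..Real.pi, q.eval (Real.sin ψ * Real.sin θ) := by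
      intro ψ
      simp only [Polynomial.eval_add]
      exact intervalIntegral.integral_add
        (((c1 p).comp (by fun_prop)).intervalIntegrable _ _)
        (((c1 q).comp (by fun_prop)).intervalIntegrable _ _)
    simp only [h1, mul_add]
    rw [intervalIntegral.integral_add
        ((continuous_sin_mul_integral (c1 p)).intervalIntegrable _ _)
        ((continuous_sin_mul_integral (c1 q)).intervalIntegrable _ _), hp, hq]
    simp only [Polynomial.eval_add]
    rw [intervalIntegral.integral_add ((c1 p).intervalIntegrable _ _)
      ((c1 q).intervalIntegrable _ _), mul_add]
  | monomial n a =>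
    have h1 : ∀ ψ, Real.sin ψ * ∫ θ in (0 : ℝ)..Real.pi,
        (Polynomial.monomial n a).eval (Real.sin ψ * Real.sin θ)
        = a * (∫ θ in (0 : ℝ)..Real.pi, Real.sin θ ^ n) * Real.sin ψ ^ (n + 1) := by
      intro ψ
      have : ∀ θ, (Polynomial.monomial n a).eval (Real.sin ψ * Real.sin θ)
          = (a * Real.sin ψ ^ n) * Real.sin θ ^ n := by
        intro θ; rw [Polynomial.eval_monomial]; ring
      simp only [this, intervalIntegral.integral_const_mul]
      ring
    simp only [h1]
    simp only [intervalIntegral.integral_const_mul, Polynomial.eval_monomial, integral_pow]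
    rw [mul_assoc, integral_sin_pow_mul_integral_sin_pow_succ]
    simp
    ring

/-- This is Archimedes' theorem: `sin ψ sin θ` is a Cartesian coordinate on the unit hemisphere with
area element `sin ψ dψ dθ`, and this coordinate is uniformly distributed on `[0, 1]`, with total
area `2π`. Polynomials reduce to Wallis integrals; Weierstrass approximation does the rest. -/
theorem abel_double_integral {φ : ℝ → ℝ} (hφ : Continuous φ) :
    ∫ ψ in (0 : ℝ)..Real.pi, Real.sin ψ * ∫ θ in (0 : ℝ)..Real.pi, φ (Real.sin ψ * Real.sin θ)
      = 2 * Real.pi * ∫ x in (0 : ℝ)..1, φ x := by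
  have hpi := Real.pi_pos
  have hmem : ∀ ψ ∈ Set.Icc 0 Real.pi, ∀ θ ∈ Set.Icc 0 Real.pi,
      Real.sin ψ * Real.sin θ ∈ Set.Icc (0 : ℝ) 1 := fun ψ hψ θ hθ =>
    ⟨mul_nonneg (Real.sin_nonneg_of_mem_Icc hψ) (Real.sin_nonneg_of_mem_Icc hθ),
      mul_le_one₀ (Real.sin_le_one _) (Real.sin_nonneg_of_mem_Icc hθ) (Real.sin_le_one _)⟩
  set A : (ℝ → ℝ) → ℝ := fun f => ∫ ψ in (0 : ℝ)..Real.pi, Real.sin ψ *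
    ∫ θ in (0 : ℝ)..Real.pi, f (Real.sin ψ * Real.sin θ) with hA
  set B : (ℝ → ℝ) → ℝ := fun f => 2 * Real.pi * ∫ x in (0 : ℝ)..1, f x with hB
  change A φ = B φ
  refine eq_of_forall_dist_le fun ε hε => ?_
  -- A uniform error `δ` in the integrand changes the left side by at most `π² δ` and the right side
  -- by at most `2π δ`.
  set δ := ε / (Real.pi ^ 2 + 2 * Real.pi) with hδ
  have hδpos : 0 < δ := by positivity
  obtain ⟨p, hp⟩ := exists_polynomial_near_of_continuousOn 0 1 φ hφ.continuousOn δ hδpos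
  have hpc : Continuous fun y : ℝ => p.eval y := p.continuous
  have hAB : A (fun y => p.eval y) = B fun y => p.eval y := abel_double_integral_polynomial p
  have h1 : ‖A φ - A fun y => p.eval y‖ ≤ (1 * (δ * |Real.pi - 0|)) * |Real.pi - 0| := by
    have : A φ - A (fun y => p.eval y) = ∫ ψ in (0 : ℝ)..Real.pi, Real.sin ψ *
        ∫ θ in (0 : ℝ)..Real.pi,
          (φ (Real.sin ψ * Real.sin θ) - p.eval (Real.sin ψ * Real.sin θ)) := by
      rw [hA]
      simp only
      rw [← intervalIntegral.integral_sub
        ((continuous_sin_mul_integral hφ).intervalIntegrable _ _)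
        ((continuous_sin_mul_integral hpc).intervalIntegrable _ _)]
      refine intervalIntegral.integral_congr fun ψ _ => ?_
      have hcomp : ∀ f : ℝ → ℝ, Continuous f →
          Continuous fun θ => f (Real.sin ψ * Real.sin θ) := fun f hf => hf.comp (by fun_prop)
      rw [intervalIntegral.integral_sub ((hcomp _ hφ).intervalIntegrable _ _)
        ((hcomp _ hpc).intervalIntegrable _ _), mul_sub]
    rw [this]
    refine intervalIntegral.norm_integral_le_of_norm_le_const fun ψ hψ => ?_
    rw [Set.uIoc_of_le hpi.le] at hψ
    rw [norm_mul]
    refine mul_le_mul (by simpa using Real.abs_sin_le_one ψ) ?_ (norm_nonneg _) zero_le_one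
    refine intervalIntegral.norm_integral_le_of_norm_le_const fun θ hθ => ?_
    rw [Set.uIoc_of_le hpi.le] at hθ
    rw [norm_sub_rev]
    exact (hp _ (hmem ψ ⟨hψ.1.le, hψ.2⟩ θ ⟨hθ.1.le, hθ.2⟩)).le
  have h2 : ‖B (fun y => p.eval y) - B φ‖ ≤ 2 * Real.pi * (δ * |(1 : ℝ) - 0|) := by
    have : B (fun y => p.eval y) - B φ
        = 2 * Real.pi * ∫ x in (0 : ℝ)..1, (p.eval x - φ x) := by
      rw [hB]
      simp only
      rw [intervalIntegral.integral_sub (hpc.intervalIntegrable _ _)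
        (hφ.intervalIntegrable _ _), mul_sub]
    rw [this, norm_mul, Real.norm_of_nonneg (by positivity : 0 ≤ 2 * Real.pi)]
    refine mul_le_mul_of_nonneg_left ?_ (by positivity)
    refine intervalIntegral.norm_integral_le_of_norm_le_const fun x hx => ?_
    rw [Set.uIoc_of_le zero_le_one] at hx
    exact (hp x ⟨hx.1.le, hx.2⟩).le
  rw [Real.dist_eq]
  calc |A φ - B φ| = ‖(A φ - A fun y => p.eval y) + (B (fun y => p.eval y) - B φ)‖ := by
        rw [hAB, Real.norm_eq_abs]; congr 1; ring
    _ ≤ _ := norm_add_le _ _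
    _ ≤ _ := add_le_add h1 h2
    _ = δ * (Real.pi ^ 2 + 2 * Real.pi) := by
        rw [sub_zero, sub_zero, abs_of_pos hpi, abs_one]; ring
    _ = ε := by rw [hδ]; field_simp
    _ ≤ ε := le_rfl

/-- Integrating the hypothesis at `s = t sin ψ` against `sin ψ` turns it, by `abel_double_integral`,
into `∫₀ᵗ φ = 0`; differentiation in `t` gives the claim. -/
theorem eq_zero_of_abel_eq_zero {R : ℝ} {φ : ℝ → ℝ} (hφ : ContinuousOn φ (Set.Ioo (-R) R))
    (h : ∀ s ∈ Set.Ioo 0 R, ∫ θ in (0 : ℝ)..Real.pi, φ (s * Real.sin θ) = 0) :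
    ∀ t ∈ Set.Ioo 0 R, φ t = 0 := by
  have hmean : ∀ t ∈ Set.Ioo 0 R, ∫ x in (0 : ℝ)..t, φ x = 0 := by
    intro t ht
    -- `abel_double_integral` asks for continuity on the whole line, so `x` is clamped to `[0, 1]`,
    -- where all the arguments lie anyway.
    have hclamp : ∀ x : ℝ, t * max 0 (min 1 x) ∈ Set.Ioo (-R) R := by
      intro x
      have h0 : 0 ≤ max 0 (min 1 x) := le_max_left _ _
      have h1 : max 0 (min 1 x) ≤ 1 := max_le zero_le_one (min_le_left _ _)
      constructor
      · nlinarith [ht.1, ht.2]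
      · nlinarith [ht.1, ht.2]
    have hc : Continuous fun x => φ (t * max 0 (min 1 x)) :=
      hφ.comp_continuous (by fun_prop) hclamp
    have habel := abel_double_integral hc
    have hid : ∀ x ∈ Set.Icc (0 : ℝ) 1, max 0 (min 1 x) = x := fun x hx => by
      rw [min_eq_right hx.2, max_eq_right hx.1]
    have hpi := Real.pi_pos
    have hleft : ∫ ψ in (0 : ℝ)..Real.pi, Real.sin ψ * ∫ θ in (0 : ℝ)..Real.pi,
        φ (t * max 0 (min 1 (Real.sin ψ * Real.sin θ))) = 0 := by
      rw [intervalIntegral.integral_of_le hpi.le, MeasureTheory.integral_Ioc_eq_integral_Ioo]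
      refine MeasureTheory.setIntegral_eq_zero_of_forall_eq_zero fun ψ hψ => ?_
      have hs := Real.sin_pos_of_mem_Ioo hψ
      have : ∫ θ in (0 : ℝ)..Real.pi, φ (t * max 0 (min 1 (Real.sin ψ * Real.sin θ)))
          = ∫ θ in (0 : ℝ)..Real.pi, φ (t * Real.sin ψ * Real.sin θ) := by
        refine intervalIntegral.integral_congr fun θ hθ => ?_
        rw [Set.uIcc_of_le hpi.le] at hθ
        have hθ' := Real.sin_nonneg_of_mem_Icc hθ
        rw [hid _ ⟨mul_nonneg hs.le hθ', mul_le_one₀ (Real.sin_le_one _) hθ'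
          (Real.sin_le_one _)⟩, mul_assoc]
      rw [this, h (t * Real.sin ψ), mul_zero]
      refine ⟨mul_pos ht.1 hs, ?_⟩
      nlinarith [ht.1, ht.2, Real.sin_le_one ψ]
    rw [hleft] at habel
    have h1 : ∫ x in (0 : ℝ)..1, φ (t * max 0 (min 1 x)) = 0 := by
      rcases mul_eq_zero.1 habel.symm with h0 | h0
      · exact absurd h0 (by positivity)
      · exact h0
    have h2 : ∫ x in (0 : ℝ)..1, φ (t * max 0 (min 1 x)) = ∫ x in (0 : ℝ)..1, φ (t * x) := by
      refine intervalIntegral.integral_congr fun x hx => ?_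
      rw [Set.uIcc_of_le zero_le_one] at hx
      simp only [hid x hx]
    rw [h2, intervalIntegral.integral_comp_mul_left _ ht.1.ne'] at h1
    simpa [ht.1.ne'] using h1
  intro t ht
  have hR : 0 < R := ht.1.trans ht.2
  have hder : HasDerivAt (fun s => ∫ x in (0 : ℝ)..s, φ x) (φ t) t := by
    have hnhds : Set.Ioo (-R) R ∈ 𝓝 t := Ioo_mem_nhds (by linarith [ht.1]) ht.2
    refine intervalIntegral.integral_hasDerivAt_right ?_
      (hφ.stronglyMeasurableAtFilter isOpen_Ioo t ⟨by linarith [ht.1], ht.2⟩)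
      (hφ.continuousAt hnhds)
    refine (hφ.mono fun x hx => ?_).intervalIntegrable
    rw [Set.uIcc_of_le ht.1.le] at hx
    exact ⟨by linarith [hx.1], by linarith [hx.2, ht.2]⟩
  refine hder.unique ((hasDerivAt_const t (0 : ℝ)).congr_of_eventuallyEq ?_)
  filter_upwards [Ioo_mem_nhds ht.1 ht.2] with s hs using hmean s hs

/-! ### Functions with partial derivatives on a square -/

/-- The open square `(-R, R)²` in the meridional half-plane coordinates. -/
def square (R : ℝ) : Set (ℝ × ℝ) := Set.Ioo (-R) R ×ˢ Set.Ioo (-R) R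

theorem isOpen_square (R : ℝ) : IsOpen (square R) := isOpen_Ioo.prod isOpen_Ioo

/-- `f₁` and `f₂` are the partial derivatives of `f` at the points of `D`. -/
structure HasPartialsOn (D : Set (ℝ × ℝ)) (f f₁ f₂ : ℝ → ℝ → ℝ) : Prop where
  fst : ∀ q ∈ D, HasDerivAt (fun r => f r q.2) (f₁ q.1 q.2) q.1
  snd : ∀ q ∈ D, HasDerivAt (fun z => f q.1 z) (f₂ q.1 q.2) q.2

/-- Near the axis the mean value inequality bounds `|u / x|` by the supremum of `|u₁|` on the
segment to the axis, which tends to `0`. The convention `u / 0 = 0` is therefore the correct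
continuous value. -/
theorem continuousOn_div_fst {R : ℝ} {u u₁ : ℝ → ℝ → ℝ}
    (hu : ContinuousOn (fun q : ℝ × ℝ => u q.1 q.2) (square R))
    (hu₁ : ContinuousOn (fun q : ℝ × ℝ => u₁ q.1 q.2) (square R))
    (hd : ∀ q ∈ square R, HasDerivAt (fun r => u r q.2) (u₁ q.1 q.2) q.1)
    (h0 : ∀ z ∈ Set.Ioo (-R) R, u 0 z = 0) (h1 : ∀ z ∈ Set.Ioo (-R) R, u₁ 0 z = 0) :
    ContinuousOn (fun q : ℝ × ℝ => u q.1 q.2 / q.1) (square R) := by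
  rintro ⟨x, z⟩ hq
  have hnhds := (isOpen_square R).mem_nhds hq
  refine ContinuousAt.continuousWithinAt ?_
  rcases eq_or_ne x 0 with rfl | hx
  · rw [Metric.continuousAt_iff]
    intro ε hε
    have hc := hu₁.continuousAt hnhds
    rw [Metric.continuousAt_iff] at hc
    obtain ⟨δ, hδ, hball⟩ := hc (ε / 2) (by positivity)
    obtain ⟨δ', hδ', hsq⟩ := Metric.mem_nhds_iff.1 hnhds
    refine ⟨min δ δ', lt_min hδ hδ', ?_⟩
    rintro ⟨y, w⟩ hyw
    have hseg : ∀ t ∈ Set.uIcc 0 y, dist ((t, w) : ℝ × ℝ) (0, z) < min δ δ' := by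
      intro t ht
      refine lt_of_le_of_lt ?_ hyw
      rw [Prod.dist_eq, Prod.dist_eq]
      refine max_le_max ?_ le_rfl
      simp only [Real.dist_eq, sub_zero]
      have := Set.abs_sub_left_of_mem_uIcc ht
      simpa using this
    have hbound : ‖u y w - u 0 w‖ ≤ ε / 2 * ‖y - 0‖ := by
      refine Convex.norm_image_sub_le_of_norm_hasDerivWithin_le (f := fun r => u r w)
        (f' := fun r => u₁ r w) (s := Set.uIcc 0 y) (fun t ht => ?_) (fun t ht => ?_)
        (convex_uIcc 0 y) Set.left_mem_uIcc Set.right_mem_uIcc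
      · exact (hd (t, w) (hsq ((hseg t ht).trans_le (min_le_right _ _)))).hasDerivWithinAt
      · have := hball ((hseg t ht).trans_le (min_le_left _ _))
        rw [Real.dist_eq] at this
        simp only [h1 z hq.2, sub_zero] at this
        exact this.le
    have hw : w ∈ Set.Ioo (-R) R :=
      (hsq ((hseg y Set.right_mem_uIcc).trans_le (min_le_right _ _)) : (y, w) ∈ square R).2
    rw [h0 w hw, sub_zero, sub_zero] at hbound
    simp only [div_zero, dist_zero_right, norm_div]
    exact lt_of_le_of_lt (div_le_of_le_mul₀ (norm_nonneg _) (by positivity) hbound) (by linarith)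
  · exact (hu.continuousAt hnhds).div continuousAt_fst hx

theorem hasDerivAt_of_punctured {f g : ℝ → ℝ} {x : ℝ}
    (hd : ∀ᶠ y in 𝓝[≠] x, HasDerivAt f (g y) y) (hf : ContinuousAt f x)
    (hg : ContinuousAt g x) : HasDerivAt f (g x) x := by
  have hR : ∀ᶠ y in 𝓝[>] x, HasDerivAt f (g y) y :=
    hd.filter_mono (nhdsWithin_mono x fun y hy => ne_of_gt hy)
  have hL : ∀ᶠ y in 𝓝[<] x, HasDerivAt f (g y) y :=
    hd.filter_mono (nhdsWithin_mono x fun y hy => ne_of_lt hy)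
  have A : HasDerivWithinAt f (g x) (Set.Ici x) x := by
    refine hasDerivWithinAt_Ici_of_tendsto_deriv (s := {y | HasDerivAt f (g y) y})
      (fun y hy => hy.differentiableAt.differentiableWithinAt) hf.continuousWithinAt hR ?_
    refine (tendsto_nhdsWithin_of_tendsto_nhds hg).congr' ?_
    filter_upwards [hR] with y hy using hy.deriv.symm
  have B : HasDerivWithinAt f (g x) (Set.Iic x) x := by
    refine hasDerivWithinAt_Iic_of_tendsto_deriv (s := {y | HasDerivAt f (g y) y})
      (fun y hy => hy.differentiableAt.differentiableWithinAt) hf.continuousWithinAt hL ?_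
    refine (tendsto_nhdsWithin_of_tendsto_nhds hg).congr' ?_
    filter_upwards [hL] with y hy using hy.deriv.symm
  simpa using B.union A

theorem uIcc_zero_subset_Ioo {R z : ℝ} (hz : z ∈ Set.Ioo (-R) R) :
    Set.uIcc 0 z ⊆ Set.Ioo (-R) R := by
  have hR : 0 < R := by linarith [hz.1, hz.2]
  exact (Set.ordConnected_Ioo).uIcc_subset ⟨by linarith, hR⟩ hz

theorem hasDerivAt_primitive {R : ℝ} {f : ℝ → ℝ} (hf : ContinuousOn f (Set.Ioo (-R) R))
    {z : ℝ} (hz : z ∈ Set.Ioo (-R) R) :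
    HasDerivAt (fun z => ∫ w in (0 : ℝ)..z, f w) (f z) z :=
  intervalIntegral.integral_hasDerivAt_right
    (hf.mono (uIcc_zero_subset_Ioo hz)).intervalIntegrable
    (hf.stronglyMeasurableAtFilter isOpen_Ioo z hz) (hf.continuousAt (Ioo_mem_nhds hz.1 hz.2))

/-- A continuous form `g dx + m dz` on a square which is closed off the axis `x = 0`, with
`m = 0` on the axis, is exact. -/
theorem exists_potential_of_closed_off_axis {R : ℝ} {g m c : ℝ → ℝ → ℝ}
    (hg : ContinuousOn (fun q : ℝ × ℝ => g q.1 q.2) (square R))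
    (hm : ContinuousOn (fun q : ℝ × ℝ => m q.1 q.2) (square R))
    (hm0 : ∀ z ∈ Set.Ioo (-R) R, m 0 z = 0)
    (hc : ContinuousOn (fun q : ℝ × ℝ => c q.1 q.2) (square R ∩ {q | q.1 ≠ 0}))
    (hmx : ∀ q ∈ square R, q.1 ≠ 0 → HasDerivAt (fun x => m x q.2) (c q.1 q.2) q.1)
    (hgz : ∀ q ∈ square R, q.1 ≠ 0 → HasDerivAt (fun z => g q.1 z) (c q.1 q.2) q.2) :
    ∃ h : ℝ → ℝ → ℝ, HasPartialsOn (square R) h g m ∧ ∀ z ∈ Set.Ioo (-R) R, h 0 z = 0 := by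
  have hgx : ∀ z ∈ Set.Ioo (-R) R, ContinuousOn (fun x => g x z) (Set.Ioo (-R) R) := fun z hz =>
    hg.comp (f := fun x => (x, z)) (by fun_prop) fun x hx => ⟨hx, hz⟩
  have hmz : ∀ x ∈ Set.Ioo (-R) R, ContinuousOn (m x) (Set.Ioo (-R) R) := fun x hx =>
    hm.comp (f := fun z => (x, z)) (by fun_prop) fun z hz => ⟨hx, hz⟩
  -- The line integral of the form from the origin to `(x, 0)` and from there parallel to the axis.
  refine ⟨fun x z => (∫ w in (0 : ℝ)..z, m x w) + ∫ t in (0 : ℝ)..x, g t 0,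
    ⟨?_, ?_⟩, fun z hz => ?_⟩
  · rintro ⟨x, z⟩ hq
    have hR : (0 : ℝ) ∈ Set.Ioo (-R) R := by
      constructor <;> linarith [hq.1.1, hq.1.2]
    have hz := uIcc_zero_subset_Ioo hq.2
    have hprim := hasDerivAt_primitive (hgx 0 hR) hq.1
    -- Differentiation under the integral sign needs `c`, which may be unbounded at the axis. At `x
    -- = 0` the derivative is obtained afterwards as the limit of the derivatives at `x ≠ 0`.
    have hoff : ∀ y ∈ Set.Ioo (-R) R, y ≠ 0 →
        HasDerivAt (fun x => ∫ w in (0 : ℝ)..z, m x w) (g y z - g y 0) y := by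
      intro y hy hy0
      have hcy : ContinuousOn (c y) (Set.uIcc 0 z) :=
        hc.comp (f := fun w => (y, w)) (by fun_prop) fun w hw => ⟨⟨hy, hz hw⟩, hy0⟩
      have hFTC : ∫ w in (0 : ℝ)..z, c y w = g y z - g y 0 :=
        intervalIntegral.integral_eq_sub_of_hasDerivAt
          (fun w hw => hgz (y, w) ⟨hy, hz hw⟩ hy0) hcy.intervalIntegrable
      rw [← hFTC]
      refine hasDerivAt_parametric_integral (U := Set.Ioo (-R) R ∩ {y | y ≠ 0})
        (isOpen_Ioo.inter isOpen_ne) (fun s hs => (hmz s hs.1).mono hz) ?_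
        (fun s hs w hw => hmx (s, w) ⟨hs.1, hz hw⟩ hs.2) ⟨hy, hy0⟩
      exact hc.mono fun p hp => ⟨⟨hp.1.1, hz hp.2⟩, hp.1.2⟩
    have hint : HasDerivAt (fun x => ∫ w in (0 : ℝ)..z, m x w) (g x z - g x 0) x := by
      have hnx : Set.Ioo (-R) R ∈ 𝓝 x := Ioo_mem_nhds hq.1.1 hq.1.2
      rcases eq_or_ne x 0 with rfl | hx
      · refine hasDerivAt_of_punctured (g := fun y => g y z - g y 0) ?_ ?_ ?_
        · filter_upwards [mem_nhdsWithin_of_mem_nhds hnx, self_mem_nhdsWithin] with y hy hy0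
            using hoff y hy hy0
        · refine (continuousOn_parametric_integral (S := Set.Ioo (-R) R) ?_).continuousAt hnx
          exact hm.mono fun p hp => ⟨hp.1, hz hp.2⟩
        · exact ((hgx z hq.2).continuousAt hnx).sub ((hgx 0 hR).continuousAt hnx)
      · exact hoff x hq.1 hx
    have hsum := hint.add hprim
    rw [sub_add_cancel] at hsum
    exact hsum
  · rintro ⟨x, z⟩ hq
    simpa using (hasDerivAt_primitive (hmz x hq.1) hq.2).add_const (∫ t in (0 : ℝ)..x, g t 0)
  · simp only [intervalIntegral.integral_same, add_zero]
    exact intervalIntegral.integral_zero_ae (Filter.Eventually.of_forall fun w hw =>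
      hm0 w (uIcc_zero_subset_Ioo hz (Set.uIoc_subset_uIcc hw)))

/-- Two functions with continuous partial derivatives which satisfy the Cauchy-Riemann equations
on a square and vanish on the axis vanish identically. -/
theorem eq_zero_of_cauchyRiemann {R : ℝ} {u v p n : ℝ → ℝ → ℝ}
    (hu : HasPartialsOn (square R) u p (fun x z => -n x z))
    (hv : HasPartialsOn (square R) v n p)
    (hp : ContinuousOn (fun q : ℝ × ℝ => p q.1 q.2) (square R))
    (hn : ContinuousOn (fun q : ℝ × ℝ => n q.1 q.2) (square R))
    (hu0 : ∀ z, u 0 z = 0) (hv0 : ∀ z, v 0 z = 0) :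
    ∀ q ∈ square R, u q.1 q.2 = 0 := by
  intro q₀ hq₀
  have hR : 0 < R := by linarith [hq₀.1.1, hq₀.1.2]
  have hstrict : ∀ {w w₁ w₂ : ℝ → ℝ → ℝ}, HasPartialsOn (square R) w w₁ w₂ →
      ContinuousOn (fun q : ℝ × ℝ => w₁ q.1 q.2) (square R) →
      ContinuousOn (fun q : ℝ × ℝ => w₂ q.1 q.2) (square R) → ∀ q ∈ square R,
      HasFDerivAt (fun q : ℝ × ℝ => w q.1 q.2)
        ((ContinuousLinearMap.toSpanSingleton ℝ (w₁ q.1 q.2)).coprod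
          (ContinuousLinearMap.toSpanSingleton ℝ (w₂ q.1 q.2))) q := by
    intro w w₁ w₂ hw h₁ h₂ q hq
    have hnhds := (isOpen_square R).mem_nhds hq
    refine (hasStrictFDerivAt_uncurry_coprod (𝕜 := ℝ) (f := w)
      (f₁ := fun x z => ContinuousLinearMap.toSpanSingleton ℝ (w₁ x z))
      (f₂ := fun x z => ContinuousLinearMap.toSpanSingleton ℝ (w₂ x z)) ?_ ?_ ?_ ?_).hasFDerivAt
    · filter_upwards [hnhds] with y hy using (hw.fst y hy).hasFDerivAt
    · filter_upwards [hnhds] with y hy using (hw.snd y hy).hasFDerivAt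
    · exact (ContinuousLinearMap.toSpanSingletonCLE (𝕜 := ℝ) (E := ℝ)).continuous.continuousAt.comp
        (h₁.continuousAt hnhds)
    · exact (ContinuousLinearMap.toSpanSingletonCLE (𝕜 := ℝ) (E := ℝ)).continuous.continuousAt.comp
        (h₂.continuousAt hnhds)
  set D : Set ℂ := Set.Ioo (-R) R ×ℂ Set.Ioo (-R) R with hD
  have hDo : IsOpen D := isOpen_Ioo.reProdIm isOpen_Ioo
  set W : ℂ → ℂ := fun w => (u w.re w.im : ℂ) + (v w.re w.im : ℂ) * Complex.I with hW
  have hdiff : DifferentiableOn ℂ W D := by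
    intro w hw
    have hq : (w.re, w.im) ∈ square R := hw
    have du := hstrict hu hp hn.neg _ hq
    have dv := hstrict hv hn hp _ hq
    have dpair : HasFDerivAt (fun w : ℂ => (w.re, w.im))
        (Complex.reCLM.prod Complex.imCLM) w :=
      (Complex.reCLM.hasFDerivAt).prodMk (Complex.imCLM.hasFDerivAt)
    have du' := Complex.ofRealCLM.hasFDerivAt.comp w (du.comp w dpair)
    have dv' := (Complex.ofRealCLM.hasFDerivAt.comp w (dv.comp w dpair)).mul_const Complex.I
    refine ((du'.add dv').complexOfReal_hasFDerivAt ?_).differentiableAt.differentiableWithinAt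
    simp
    ring_nf
    simp
  have hanal : AnalyticOnNhd ℂ W D := hdiff.analyticOnNhd hDo
  have hconn : IsPreconnected D :=
    (((convex_Ioo (-R) R).linear_preimage Complex.reLm).inter
      ((convex_Ioo (-R) R).linear_preimage Complex.imLm)).isPreconnected
  have h0D : (0 : ℂ) ∈ D := ⟨⟨by simpa using hR, by simpa using hR⟩,
    ⟨by simpa using hR, by simpa using hR⟩⟩
  -- The axis `x = 0` is the imaginary axis, along which zeros of `W` accumulate at `0`.
  have hfreq : ∃ᶠ w in 𝓝[≠] (0 : ℂ), W w = 0 := by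
    have hmap : Filter.Tendsto (fun t : ℝ => (t : ℂ) * Complex.I) (𝓝[≠] 0) (𝓝[≠] 0) := by
      refine tendsto_nhdsWithin_iff.2 ⟨?_, ?_⟩
      · refine tendsto_nhdsWithin_of_tendsto_nhds ?_
        have : Continuous fun t : ℝ => (t : ℂ) * Complex.I := by fun_prop
        simpa using this.tendsto 0
      · filter_upwards [self_mem_nhdsWithin] with t ht
        simpa using ht
    refine hmap.frequently (Filter.Eventually.frequently ?_)
    exact Filter.Eventually.of_forall fun t => by simp [hW, hu0, hv0]
  have hzero := hanal.eqOn_zero_of_preconnected_of_frequently_eq_zero hconn h0D hfreq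
    (x := ⟨q₀.1, q₀.2⟩) hq₀
  simpa [hW] using congrArg Complex.re hzero

/-! ### Uniqueness for the axisymmetric stream-function equation -/

theorem mul_sin_mem_Ioo {R s : ℝ} (hs : s ∈ Set.Ioo (-R) R) (θ : ℝ) :
    s * Real.sin θ ∈ Set.Ioo (-R) R := by
  have h : |s * Real.sin θ| < R := by
    rw [abs_mul]
    exact (mul_le_of_le_one_right (abs_nonneg _) (Real.abs_sin_le_one θ)).trans_lt
      (abs_lt.2 hs)
  exact abs_lt.1 h

/-- A solution `f` of `f_xx - f_x / x + f_zz = 0` on a square for which `f`, `f_x` and `f_xx`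
vanish on the axis `x = 0` is zero. -/
theorem eq_zero_of_stream_equation {R : ℝ} {f f₁ f₂ f₁₁ f₁₂ f₂₂ : ℝ → ℝ → ℝ}
    (hf : HasPartialsOn (square R) f f₁ f₂) (hf₁ : HasPartialsOn (square R) f₁ f₁₁ f₁₂)
    (hf₂ : HasPartialsOn (square R) f₂ f₁₂ f₂₂)
    (c : ContinuousOn (fun q : ℝ × ℝ => f q.1 q.2) (square R))
    (c₁ : ContinuousOn (fun q : ℝ × ℝ => f₁ q.1 q.2) (square R))
    (c₂ : ContinuousOn (fun q : ℝ × ℝ => f₂ q.1 q.2) (square R))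
    (c₁₁ : ContinuousOn (fun q : ℝ × ℝ => f₁₁ q.1 q.2) (square R))
    (c₁₂ : ContinuousOn (fun q : ℝ × ℝ => f₁₂ q.1 q.2) (square R))
    (c₂₂ : ContinuousOn (fun q : ℝ × ℝ => f₂₂ q.1 q.2) (square R))
    (h0 : ∀ z ∈ Set.Ioo (-R) R, f 0 z = 0) (h1 : ∀ z ∈ Set.Ioo (-R) R, f₁ 0 z = 0)
    (h11 : ∀ z ∈ Set.Ioo (-R) R, f₁₁ 0 z = 0)
    (hpde : ∀ q ∈ square R, q.1 ≠ 0 → f₁₁ q.1 q.2 - f₁ q.1 q.2 / q.1 + f₂₂ q.1 q.2 = 0) :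
    ∀ q ∈ square R, 0 < q.1 → f q.1 q.2 = 0 := by
  intro q₀ hq₀ hq₀pos
  have h0R : (0 : ℝ) ∈ Set.Ioo (-R) R := by
    constructor <;> linarith [hq₀.1.1, hq₀.1.2]
  have haxis : ∀ {w w' : ℝ → ℝ → ℝ}, (∀ z ∈ Set.Ioo (-R) R, w 0 z = 0) →
      (∀ q ∈ square R, HasDerivAt (fun z => w q.1 z) (w' q.1 q.2) q.2) →
      ∀ z ∈ Set.Ioo (-R) R, w' 0 z = 0 := by
    intro w w' hw hw' z hz
    refine (hw' (0, z) ⟨h0R, hz⟩).unique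
      ((hasDerivAt_const z (0 : ℝ)).congr_of_eventuallyEq ?_)
    filter_upwards [Ioo_mem_nhds hz.1 hz.2] with y hy using hw y hy
  have h2 : ∀ z ∈ Set.Ioo (-R) R, f₂ 0 z = 0 := haxis h0 hf.snd
  have h12 : ∀ z ∈ Set.Ioo (-R) R, f₁₂ 0 z = 0 := haxis h1 hf₁.snd
  set g : ℝ → ℝ → ℝ := fun x z => -(f₂ x z / x) with hgdef
  have cq := continuousOn_div_fst c c₁ hf.fst h0 h1
  have cm := continuousOn_div_fst c₁ c₁₁ hf₁.fst h1 h11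
  have cg : ContinuousOn (fun q : ℝ × ℝ => g q.1 q.2) (square R) :=
    (continuousOn_div_fst c₂ c₁₂ hf₂.fst h2 h12).neg
  -- The conjugate function `h`, with `h_x = -f_z/x` and `h_z = f_x/x`; closedness is the stream
  -- equation. Continuity of `f_x/x` with value `0` on the axis rests on `f_xx = 0` there, the
  -- condition which excludes the solution `f = x²`.
  obtain ⟨h, hh, hh0⟩ := exists_potential_of_closed_off_axis (g := g)
    (m := fun x z => f₁ x z / x) (c := fun x z => -(f₂₂ x z / x)) cg cm
    (fun z _ => div_zero _)
    ((c₂₂.mono Set.inter_subset_left).div continuousOn_fst (fun q hq => hq.2)).neg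
    (fun q hq hne => by
      have := (hf₁.fst q hq).div (hasDerivAt_id q.1) hne
      convert! this using 1
      have := hpde q hq hne
      have h22 : f₂₂ q.1 q.2 = f₁ q.1 q.2 / q.1 - f₁₁ q.1 q.2 := by linarith
      rw [h22]
      simp only [id]
      field_simp
      ring)
    (fun q hq hne => ((hf₂.snd q hq).div_const q.1).neg)
  clear_value g
  have hmap : ∀ z ∈ Set.Ioo (-R) R, ∀ s ∈ Set.Ioo (-R) R, ∀ θ : ℝ,
      (s * Real.sin θ, z) ∈ square R := fun z hz s hs θ => ⟨mul_sin_mem_Ioo hs θ, hz⟩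
  have cs : ∀ {w : ℝ → ℝ → ℝ}, ContinuousOn (fun q : ℝ × ℝ => w q.1 q.2) (square R) →
      ∀ z ∈ Set.Ioo (-R) R, ContinuousOn
        (fun p : ℝ × ℝ => w (p.1 * Real.sin p.2) z)
        (Set.Ioo (-R) R ×ˢ Set.uIcc 0 Real.pi) := fun hw z hz =>
    hw.comp (f := fun p : ℝ × ℝ => (p.1 * Real.sin p.2, z)) (by fun_prop)
      fun p hp => hmap z hz p.1 hp.1 p.2
  have cz : ∀ {w : ℝ → ℝ → ℝ}, ContinuousOn (fun q : ℝ × ℝ => w q.1 q.2) (square R) →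
      ∀ s ∈ Set.Ioo (-R) R, ContinuousOn
        (fun p : ℝ × ℝ => w (s * Real.sin p.2) p.1)
        (Set.Ioo (-R) R ×ˢ Set.uIcc 0 Real.pi) := fun hw s hs =>
    hw.comp (f := fun p : ℝ × ℝ => (s * Real.sin p.2, p.1)) (by fun_prop)
      fun p hp => hmap p.1 hp.1 s hs p.2
  have cθ : ∀ {w : ℝ → ℝ → ℝ}, ContinuousOn (fun q : ℝ × ℝ => w q.1 q.2) (square R) →
      ∀ z ∈ Set.Ioo (-R) R, ∀ s ∈ Set.Ioo (-R) R, Continuous fun θ => w (s * Real.sin θ) z :=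
    fun hw z hz s hs => hw.comp_continuous (f := fun θ => (s * Real.sin θ, z)) (by fun_prop)
      (hmap z hz s hs)
  have cpar : ∀ {w : ℝ → ℝ → ℝ}, ContinuousOn (fun q : ℝ × ℝ => w q.1 q.2) (square R) →
      ContinuousOn (fun p : (ℝ × ℝ) × ℝ => w (p.1.1 * Real.sin p.2) p.1.2)
        (square R ×ˢ Set.uIcc 0 Real.pi) := fun hw =>
    hw.comp (f := fun p : (ℝ × ℝ) × ℝ => (p.1.1 * Real.sin p.2, p.1.2)) (by fun_prop)
      fun p hp => hmap p.1.2 hp.1.2 p.1.1 hp.1.1 p.2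
  have hhx : ∀ z ∈ Set.Ioo (-R) R, ContinuousOn (fun x => h x z) (Set.Ioo (-R) R) :=
    fun z hz x hx => (hh.fst (x, z) ⟨hx, hz⟩).continuousAt.continuousWithinAt
  have hhθ : ∀ z ∈ Set.Ioo (-R) R, ∀ s ∈ Set.Ioo (-R) R,
      Continuous fun θ => h (s * Real.sin θ) z := fun z hz s hs =>
    (hhx z hz).comp_continuous (by fun_prop) (mul_sin_mem_Ioo hs)
  have hsin : ∀ s θ : ℝ, HasDerivAt (fun s => s * Real.sin θ) (Real.sin θ) s := fun s θ => by
    simpa using (hasDerivAt_id s).mul_const (Real.sin θ)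
  -- The integrand is `f(s sin θ, z) / sin θ`, written so that division by zero gives the right
  -- value `0` when `s = 0` or `sin θ = 0`.
  have hQ : HasPartialsOn (square R)
      (fun s z => ∫ θ in (0 : ℝ)..Real.pi, s * (f (s * Real.sin θ) z / (s * Real.sin θ)))
      (fun s z => ∫ θ in (0 : ℝ)..Real.pi, f₁ (s * Real.sin θ) z)
      (fun s z => -∫ θ in (0 : ℝ)..Real.pi, s * g (s * Real.sin θ) z) := by
    constructor
    · rintro ⟨s, z⟩ ⟨hs, hz⟩
      refine hasDerivAt_parametric_integral
        (Φ := fun s θ => s * (f (s * Real.sin θ) z / (s * Real.sin θ)))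
        (Φ' := fun s θ => f₁ (s * Real.sin θ) z) isOpen_Ioo
        (fun s hs => (continuous_const.mul
          (cθ (w := fun x z => f x z / x) cq z hz s hs)).continuousOn) (cs c₁ z hz) ?_ hs
      intro s hs θ _
      rcases eq_or_ne (Real.sin θ) 0 with hθ | hθ
      · simp only [hθ, mul_zero, div_zero, h1 z hz]
        exact hasDerivAt_const s 0
      · have heq : (fun s => s * (f (s * Real.sin θ) z / (s * Real.sin θ)))
            = fun s => f (s * Real.sin θ) z / Real.sin θ := by
          funext s
          rcases eq_or_ne s 0 with rfl | hs0
          · simp [h0 z hz]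
          · field_simp
        rw [heq]
        have := ((hf.fst (s * Real.sin θ, z) (hmap z hz s hs θ)).comp s (hsin s θ)).div_const
          (Real.sin θ)
        rwa [mul_div_cancel_right₀ _ hθ] at this
    · rintro ⟨s, z⟩ ⟨hs, hz⟩
      have := hasDerivAt_parametric_integral (a := 0) (b := Real.pi)
        (Φ := fun z θ => s * (f (s * Real.sin θ) z / (s * Real.sin θ)))
        (Φ' := fun z θ => -(s * g (s * Real.sin θ) z)) isOpen_Ioo
        (fun z hz => (continuous_const.mul
          (cθ (w := fun x z => f x z / x) cq z hz s hs)).continuousOn)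
        (continuousOn_const.mul (cz cg s hs)).neg (fun z hz θ _ => by
          have := ((hf.snd (s * Real.sin θ, z) (hmap z hz s hs θ)).div_const
            (s * Real.sin θ)).const_mul s
          convert! this using 1
          simp only [hgdef]
          ring) hz
      rwa [intervalIntegral.integral_neg] at this
  have hG : HasPartialsOn (square R)
      (fun s z => ∫ θ in (0 : ℝ)..Real.pi, s * Real.sin θ * h (s * Real.sin θ) z)
      (fun s z => ∫ θ in (0 : ℝ)..Real.pi, s * g (s * Real.sin θ) z)
      (fun s z => ∫ θ in (0 : ℝ)..Real.pi, f₁ (s * Real.sin θ) z) := by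
    constructor
    · rintro ⟨s, z⟩ ⟨hs, hz⟩
      have hcomp : ∀ s ∈ Set.Ioo (-R) R, ∀ θ : ℝ, ∀ {φ : ℝ → ℝ} {φ' x : ℝ},
          HasDerivAt φ φ' x → (hx : φ x = s * Real.sin θ := by rfl) →
          HasDerivAt (fun y => h (φ y) z) (g (s * Real.sin θ) z * φ') x := by
        intro s hs θ φ φ' x hφ hx
        have := hh.fst (s * Real.sin θ, z) (hmap z hz s hs θ)
        rw [← hx] at this ⊢
        exact this.comp x hφ
      have hder := hasDerivAt_parametric_integral (a := 0) (b := Real.pi)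
        (Φ := fun s θ => s * Real.sin θ * h (s * Real.sin θ) z)
        (Φ' := fun s θ => Real.sin θ * h (s * Real.sin θ) z
          + s * Real.sin θ * (g (s * Real.sin θ) z * Real.sin θ)) isOpen_Ioo
        (fun s hs => ((continuous_const.mul Real.continuous_sin).mul
          (hhθ z hz s hs)).continuousOn)
        (((by fun_prop : ContinuousOn (fun p : ℝ × ℝ => Real.sin p.2) _).mul
          ((hhx z hz).comp (f := fun p : ℝ × ℝ => p.1 * Real.sin p.2) (by fun_prop)
            fun p hp => mul_sin_mem_Ioo hp.1 p.2)).add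
          ((by fun_prop : ContinuousOn (fun p : ℝ × ℝ => p.1 * Real.sin p.2) _).mul
            ((cs cg z hz).mul
              (by fun_prop : ContinuousOn (fun p : ℝ × ℝ => Real.sin p.2) _))))
        (fun s hs θ _ => (hsin s θ).mul (hcomp s hs θ (hsin s θ))) hs
      convert! hder using 1
      have hgc := cθ cg z hz s hs
      have hhc := hhθ z hz s hs
      -- Integration by parts trades `∫ sin θ · h` for `∫ s cos² θ · g`, which combines with `∫ s
      -- sin² θ · g` to `∫ s g`. The boundary terms vanish because `h = 0` on the axis.
      have hparts : ∫ θ in (0 : ℝ)..Real.pi, (Real.sin θ * h (s * Real.sin θ) z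
          + -Real.cos θ * (g (s * Real.sin θ) z * (s * Real.cos θ)))
          = -Real.cos Real.pi * h (s * Real.sin Real.pi) z
            - -Real.cos 0 * h (s * Real.sin 0) z := by
        refine intervalIntegral.integral_eq_sub_of_hasDerivAt
          (f := fun θ => -Real.cos θ * h (s * Real.sin θ) z) (fun θ _ => ?_)
          (Continuous.intervalIntegrable ((Real.continuous_sin.mul hhc).add
            (Real.continuous_cos.neg.mul (hgc.mul (continuous_const.mul Real.continuous_cos)))) _ _)
        have hc := (Real.hasDerivAt_cos θ).neg
        rw [neg_neg] at hc
        exact hc.mul (hcomp s hs θ ((Real.hasDerivAt_sin θ).const_mul s))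
      simp only [Real.sin_pi, Real.sin_zero, mul_zero, hh0 z hz, sub_zero] at hparts
      have hrhs : Continuous fun θ => Real.sin θ * h (s * Real.sin θ) z
          + s * Real.sin θ * (g (s * Real.sin θ) z * Real.sin θ) :=
        (Real.continuous_sin.mul hhc).add
          ((continuous_const.mul Real.continuous_sin).mul (hgc.mul Real.continuous_sin))
      have hlhs : Continuous fun θ => s * g (s * Real.sin θ) z := continuous_const.mul hgc
      refine (sub_eq_zero.1 ?_).symm
      rw [← intervalIntegral.integral_sub (hrhs.intervalIntegrable _ _)
        (hlhs.intervalIntegrable _ _)]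
      refine Eq.trans ?_ hparts
      refine intervalIntegral.integral_congr fun θ _ => ?_
      linear_combination (s * g (s * Real.sin θ) z) * Real.sin_sq_add_cos_sq θ
    · rintro ⟨s, z⟩ ⟨hs, hz⟩
      refine hasDerivAt_parametric_integral (a := 0) (b := Real.pi)
        (Φ := fun z θ => s * Real.sin θ * h (s * Real.sin θ) z)
        (Φ' := fun z θ => f₁ (s * Real.sin θ) z) isOpen_Ioo
        (fun z hz => ((continuous_const.mul Real.continuous_sin).mul
          (hhθ z hz s hs)).continuousOn) (cz c₁ s hs) (fun z hz θ _ => ?_) hz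
      have := (hh.snd (s * Real.sin θ, z) (hmap z hz s hs θ)).const_mul (s * Real.sin θ)
      convert! this using 1
      rcases eq_or_ne (s * Real.sin θ) 0 with hθ | hθ
      · simp only [hθ, h1 z hz, zero_mul]
      · simp only [mul_div_cancel₀ _ hθ]
  have hQzero := eq_zero_of_cauchyRiemann hQ hG
    (continuousOn_parametric_integral (Φ := fun q : ℝ × ℝ => fun θ => f₁ (q.1 * Real.sin θ) q.2)
      (cpar c₁))
    (continuousOn_parametric_integral
      (Φ := fun q : ℝ × ℝ => fun θ => q.1 * g (q.1 * Real.sin θ) q.2)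
      ((by fun_prop : ContinuousOn (fun p : (ℝ × ℝ) × ℝ => p.1.1) _).mul (cpar cg)))
    (fun z => by simp) (fun z => by simp)
  have habel := eq_zero_of_abel_eq_zero (φ := fun x => f x q₀.2 / x)
    (cq.comp (f := fun x => (x, q₀.2)) (by fun_prop) fun x hx => ⟨hx, hq₀.2⟩)
    (fun s hs => by
      have := hQzero (s, q₀.2) ⟨⟨by linarith [hs.1, hs.2], hs.2⟩, hq₀.2⟩
      simp only [intervalIntegral.integral_const_mul] at this
      exact (mul_eq_zero.1 this).resolve_left hs.1.ne') q₀.1 ⟨hq₀pos, hq₀.1.2⟩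
  simpa [hq₀pos.ne'] using habel

/-! ### The Levi-Civita connection of the Weyl metric -/

theorem pderiv_meridional (F : ℝ → ℝ → ℝ) (p : Fin 4 → ℝ) :
    pderiv 0 (fun q => F (q 1) (q 2)) p = 0 ∧
    pderiv 1 (fun q => F (q 1) (q 2)) p = deriv (fun r => F r (p 2)) (p 1) ∧
    pderiv 2 (fun q => F (q 1) (q 2)) p = deriv (fun z => F (p 1) z) (p 2) ∧
    pderiv 3 (fun q => F (q 1) (q 2)) p = 0 := by
  simp [pderiv]

/-- Components of the Weyl metric at `(ρ, ζ)` as a function of `r = ρ`, `u = U`, `A = a`,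
`κ = k`. -/
def weylComponents (r u A κ : ℝ) : Matrix (Fin 4) (Fin 4) ℝ :=
  !![-Real.exp (2 * u), 0, 0, -(Real.exp (2 * u) * A);
     0, Real.exp (-2 * u) * Real.exp (2 * κ), 0, 0;
     0, 0, Real.exp (-2 * u) * Real.exp (2 * κ), 0;
     -(Real.exp (2 * u) * A), 0, 0,
       Real.exp (-2 * u) * r ^ 2 - Real.exp (2 * u) * A ^ 2]

theorem weylMetric_eq (U a k : ℝ → ℝ → ℝ) (p : Fin 4 → ℝ) :
    weylMetric U a k p = weylComponents (p 1) (U (p 1) (p 2)) (a (p 1) (p 2)) (k (p 1) (p 2)) :=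
  rfl

/-- Derivative of the metric components along a curve, in terms of `E = e^{2U}`, `K = e^{2k}` and
the derivatives `r'`, `u'`, `A'`, `κ'` of their arguments. -/
def weylDeriv (r E A K r' u' A' κ' : ℝ) : Matrix (Fin 4) (Fin 4) ℝ :=
  !![-(2 * E * u'), 0, 0, -(2 * E * u' * A + E * A');
     0, E⁻¹ * K * (2 * κ' - 2 * u'), 0, 0;
     0, 0, E⁻¹ * K * (2 * κ' - 2 * u'), 0;
     -(2 * E * u' * A + E * A'), 0, 0,
       E⁻¹ * (2 * r * r') - 2 * u' * E⁻¹ * r ^ 2 - 2 * E * u' * A ^ 2 - E * (2 * A * A')]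

theorem exp_neg_two_mul (u : ℝ) : Real.exp (-2 * u) = (Real.exp (2 * u))⁻¹ := by
  rw [← Real.exp_neg]; ring_nf

theorem hasDerivAt_weylComponents {r u A κ : ℝ → ℝ} {r' u' A' κ' s : ℝ} (hr : HasDerivAt r r' s)
    (hu : HasDerivAt u u' s) (hA : HasDerivAt A A' s) (hκ : HasDerivAt κ κ' s) (i j : Fin 4) :
    HasDerivAt (fun s => weylComponents (r s) (u s) (A s) (κ s) i j)
      (weylDeriv (r s) (Real.exp (2 * u s)) (A s) (Real.exp (2 * κ s)) r' u' A' κ' i j) s := by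
  have hE : HasDerivAt (fun s => Real.exp (2 * u s)) (Real.exp (2 * u s) * (2 * u')) s :=
    (hu.const_mul 2).exp
  have hE' : HasDerivAt (fun s => Real.exp (-2 * u s)) (Real.exp (-2 * u s) * (-2 * u')) s :=
    (hu.const_mul (-2)).exp
  have hK : HasDerivAt (fun s => Real.exp (2 * κ s)) (Real.exp (2 * κ s) * (2 * κ')) s :=
    (hκ.const_mul 2).exp
  have h0 := hasDerivAt_const s (0 : ℝ)
  have e := exp_neg_two_mul (u s)
  have h00 := hE.fun_neg.congr_deriv
    (show _ = -(2 * Real.exp (2 * u s) * u') by ring)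
  have h03 := (hE.fun_mul hA).fun_neg.congr_deriv
    (show _ = -(2 * Real.exp (2 * u s) * u' * A s + Real.exp (2 * u s) * A') by ring)
  have h11 := (hE'.fun_mul hK).congr_deriv
    (show _ = (Real.exp (2 * u s))⁻¹ * Real.exp (2 * κ s) * (2 * κ' - 2 * u') by rw [e]; ring)
  have h33 := ((hE'.fun_mul (hr.fun_pow 2)).fun_sub (hE.fun_mul (hA.fun_pow 2))).congr_deriv
    (show _ = (Real.exp (2 * u s))⁻¹ * (2 * r s * r') - 2 * u' * (Real.exp (2 * u s))⁻¹ * r s ^ 2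
      - 2 * Real.exp (2 * u s) * u' * A s ^ 2 - Real.exp (2 * u s) * (2 * A s * A') by
        rw [e]; push_cast; ring)
  fin_cases i <;> fin_cases j <;> first | exact h0 | exact h00 | exact h03 | exact h11 | exact h33

theorem weylComponents_inv {r : ℝ} (hr : r ≠ 0) (u A κ : ℝ) :
    (weylComponents r u A κ)⁻¹ =
      !![-(Real.exp (2 * u))⁻¹ + Real.exp (2 * u) * A ^ 2 / r ^ 2, 0, 0,
          -(Real.exp (2 * u) * A / r ^ 2);
        0, Real.exp (2 * u) / Real.exp (2 * κ), 0, 0;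
        0, 0, Real.exp (2 * u) / Real.exp (2 * κ), 0;
        -(Real.exp (2 * u) * A / r ^ 2), 0, 0, Real.exp (2 * u) / r ^ 2] := by
  refine Matrix.inv_eq_right_inv ?_
  have hE : Real.exp (2 * u) ≠ 0 := (Real.exp_pos _).ne'
  have hK : Real.exp (2 * κ) ≠ 0 := (Real.exp_pos _).ne'
  ext i j
  simp only [weylComponents, exp_neg_two_mul, Matrix.mul_apply, Fin.sum_univ_four]
  fin_cases i <;> fin_cases j <;> simp <;> field_simp <;> ring

/-- Christoffel symbols of the Weyl metric in terms of `r = ρ`, `E = e^{2U}`, `A = a`,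
`K = e^{2k}` and the partial derivatives of `U`, `a` and `k`. -/
def christoffelTable (r E A K u₁ u₂ a₁ a₂ k₁ k₂ : ℝ) : Fin 4 → Matrix (Fin 4) (Fin 4) ℝ :=
  ![!![0, u₁ + E ^ 2 * A * a₁ / (2 * r ^ 2), u₂ + E ^ 2 * A * a₂ / (2 * r ^ 2), 0;
       u₁ + E ^ 2 * A * a₁ / (2 * r ^ 2), 0, 0,
         2 * A * u₁ + a₁ / 2 + E ^ 2 * A ^ 2 * a₁ / (2 * r ^ 2) - A / r;
       u₂ + E ^ 2 * A * a₂ / (2 * r ^ 2), 0, 0,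
         2 * A * u₂ + a₂ / 2 + E ^ 2 * A ^ 2 * a₂ / (2 * r ^ 2);
       0, 2 * A * u₁ + a₁ / 2 + E ^ 2 * A ^ 2 * a₁ / (2 * r ^ 2) - A / r,
         2 * A * u₂ + a₂ / 2 + E ^ 2 * A ^ 2 * a₂ / (2 * r ^ 2), 0],
    !![E ^ 2 / K * u₁, 0, 0, E ^ 2 / K * (u₁ * A + a₁ / 2);
       0, k₁ - u₁, k₂ - u₂, 0;
       0, k₂ - u₂, -(k₁ - u₁), 0;
       E ^ 2 / K * (u₁ * A + a₁ / 2), 0, 0,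
         -((r - r ^ 2 * u₁ - E ^ 2 * u₁ * A ^ 2 - E ^ 2 * A * a₁) / K)],
    !![E ^ 2 / K * u₂, 0, 0, E ^ 2 / K * (u₂ * A + a₂ / 2);
       0, -(k₂ - u₂), k₁ - u₁, 0;
       0, k₁ - u₁, k₂ - u₂, 0;
       E ^ 2 / K * (u₂ * A + a₂ / 2), 0, 0,
         -((-(r ^ 2 * u₂) - E ^ 2 * u₂ * A ^ 2 - E ^ 2 * A * a₂) / K)],
    !![0, -(E ^ 2 * a₁ / (2 * r ^ 2)), -(E ^ 2 * a₂ / (2 * r ^ 2)), 0;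
       -(E ^ 2 * a₁ / (2 * r ^ 2)), 0, 0, 1 / r - (u₁ + E ^ 2 * A * a₁ / (2 * r ^ 2));
       -(E ^ 2 * a₂ / (2 * r ^ 2)), 0, 0, -(u₂ + E ^ 2 * A * a₂ / (2 * r ^ 2));
       0, 1 / r - (u₁ + E ^ 2 * A * a₁ / (2 * r ^ 2)), -(u₂ + E ^ 2 * A * a₂ / (2 * r ^ 2)), 0]]

/-- The partial derivatives of the components of the Weyl metric. -/
theorem pderiv_weylMetric {D : Set (ℝ × ℝ)} {U a k U₁ U₂ a₁ a₂ k₁ k₂ : ℝ → ℝ → ℝ}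
    (hU : HasPartialsOn D U U₁ U₂) (ha : HasPartialsOn D a a₁ a₂) (hk : HasPartialsOn D k k₁ k₂)
    {p : Fin 4 → ℝ} (hp : (p 1, p 2) ∈ D) (i j : Fin 4) :
    pderiv 0 (fun q => weylMetric U a k q i j) p = 0 ∧
    pderiv 1 (fun q => weylMetric U a k q i j) p =
      weylDeriv (p 1) (Real.exp (2 * U (p 1) (p 2))) (a (p 1) (p 2)) (Real.exp (2 * k (p 1) (p 2)))
        1 (U₁ (p 1) (p 2)) (a₁ (p 1) (p 2)) (k₁ (p 1) (p 2)) i j ∧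
    pderiv 2 (fun q => weylMetric U a k q i j) p =
      weylDeriv (p 1) (Real.exp (2 * U (p 1) (p 2))) (a (p 1) (p 2)) (Real.exp (2 * k (p 1) (p 2)))
        0 (U₂ (p 1) (p 2)) (a₂ (p 1) (p 2)) (k₂ (p 1) (p 2)) i j ∧
    pderiv 3 (fun q => weylMetric U a k q i j) p = 0 := by
  obtain ⟨h0, h1, h2, h3⟩ := pderiv_meridional
    (fun r z => weylComponents r (U r z) (a r z) (k r z) i j) p
  refine ⟨h0, h1.trans (HasDerivAt.deriv ?_), h2.trans (HasDerivAt.deriv ?_), h3⟩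
  · exact hasDerivAt_weylComponents (hasDerivAt_id' _) (hU.fst _ hp) (ha.fst _ hp) (hk.fst _ hp) i j
  · exact hasDerivAt_weylComponents (hasDerivAt_const _ _) (hU.snd _ hp) (ha.snd _ hp)
      (hk.snd _ hp) i j

theorem christoffel_weylMetric {D : Set (ℝ × ℝ)} {U a k U₁ U₂ a₁ a₂ k₁ k₂ : ℝ → ℝ → ℝ}
    (hU : HasPartialsOn D U U₁ U₂) (ha : HasPartialsOn D a a₁ a₂) (hk : HasPartialsOn D k k₁ k₂)
    {p : Fin 4 → ℝ} (hp : (p 1, p 2) ∈ D) (hr : p 1 ≠ 0) (c i j : Fin 4) :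
    christoffel (weylMetric U a k) c i j p =
      christoffelTable (p 1) (Real.exp (2 * U (p 1) (p 2))) (a (p 1) (p 2))
        (Real.exp (2 * k (p 1) (p 2))) (U₁ (p 1) (p 2)) (U₂ (p 1) (p 2)) (a₁ (p 1) (p 2))
        (a₂ (p 1) (p 2)) (k₁ (p 1) (p 2)) (k₂ (p 1) (p 2)) c i j := by
  have hd := pderiv_weylMetric hU ha hk hp
  unfold christoffel
  rw [weylMetric_eq, weylComponents_inv hr]
  have hE : Real.exp (2 * U (p 1) (p 2)) ≠ 0 := (Real.exp_pos _).ne'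
  have hK : Real.exp (2 * k (p 1) (p 2)) ≠ 0 := (Real.exp_pos _).ne'
  have hd0 := fun i j => (hd i j).1
  have hd1 := fun i j => (hd i j).2.1
  have hd2 := fun i j => (hd i j).2.2.1
  have hd3 := fun i j => (hd i j).2.2.2
  generalize Real.exp (2 * U (p 1) (p 2)) = E at *
  generalize Real.exp (2 * k (p 1) (p 2)) = K at *
  fin_cases c <;> fin_cases i <;> fin_cases j <;>
    simp [Fin.sum_univ_four, hd0, hd1, hd2, hd3, weylDeriv, christoffelTable] <;>
    field_simp <;> ring

/-! ### The Ricci tensor of the Weyl metric -/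

section CurveDerivatives

variable {r u A κ v b : ℝ → ℝ} {r' u' A' κ' v' b' s : ℝ}

/-- The curve parameter `s` stands for either of `ρ` and `ζ`, and `v` for either first derivative of
`U`, so one formula covers all partial derivatives of the symbols of this type. -/
theorem hasDerivAt_christoffel_tt (hu : HasDerivAt u u' s) (hκ : HasDerivAt κ κ' s)
    (hv : HasDerivAt v v' s) :
    HasDerivAt (fun s => Real.exp (2 * u s) ^ 2 / Real.exp (2 * κ s) * v s)
      (Real.exp (2 * u s) ^ 2 / Real.exp (2 * κ s) * (v' + (4 * u' - 2 * κ') * v s)) s := by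
  have hE := (hu.const_mul 2).exp
  have hK := (hκ.const_mul 2).exp
  have hK0 : Real.exp (2 * κ s) ≠ 0 := (Real.exp_pos _).ne'
  refine (((hE.fun_pow 2).fun_div hK hK0).fun_mul hv).congr_deriv ?_
  field_simp
  push_cast
  ring

theorem hasDerivAt_christoffel_tphi (hu : HasDerivAt u u' s) (hA : HasDerivAt A A' s)
    (hκ : HasDerivAt κ κ' s) (hv : HasDerivAt v v' s) (hb : HasDerivAt b b' s) :
    HasDerivAt (fun s => Real.exp (2 * u s) ^ 2 / Real.exp (2 * κ s) * (v s * A s + b s / 2))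
      (Real.exp (2 * u s) ^ 2 / Real.exp (2 * κ s) * (v' * A s + v s * A' + b' / 2
        + (4 * u' - 2 * κ') * (v s * A s + b s / 2))) s :=
  hasDerivAt_christoffel_tt hu hκ ((hv.fun_mul hA).fun_add (hb.div_const 2))

/-- The extra function `d` is half the derivative of `ρ²`: it is `ρ` for the upper index `ρ` and `0`
for the upper index `ζ`. -/
theorem hasDerivAt_christoffel_phiphi {d : ℝ → ℝ} {d' : ℝ} (hr : HasDerivAt r r' s)
    (hu : HasDerivAt u u' s) (hA : HasDerivAt A A' s) (hκ : HasDerivAt κ κ' s)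
    (hv : HasDerivAt v v' s) (hb : HasDerivAt b b' s) (hd : HasDerivAt d d' s) :
    HasDerivAt (fun s => -((d s - r s ^ 2 * v s - Real.exp (2 * u s) ^ 2 * v s * A s ^ 2
        - Real.exp (2 * u s) ^ 2 * A s * b s) / Real.exp (2 * κ s)))
      (-((d' - 2 * r s * r' * v s - r s ^ 2 * v'
        - Real.exp (2 * u s) ^ 2 * (4 * u' * v s * A s ^ 2 + v' * A s ^ 2 + 2 * v s * A s * A'
          + 4 * u' * A s * b s + A' * b s + A s * b')) / Real.exp (2 * κ s))
        + 2 * κ' * (d s - r s ^ 2 * v s - Real.exp (2 * u s) ^ 2 * v s * A s ^ 2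
        - Real.exp (2 * u s) ^ 2 * A s * b s) / Real.exp (2 * κ s)) s := by
  have hE := ((hu.const_mul 2).exp).fun_pow 2
  have hK := (hκ.const_mul 2).exp
  have hK0 : Real.exp (2 * κ s) ≠ 0 := (Real.exp_pos _).ne'
  refine ((((hd.fun_sub ((hr.fun_pow 2).fun_mul hv)).fun_sub ((hE.fun_mul hv).fun_mul
    (hA.fun_pow 2))).fun_sub ((hE.fun_mul hA).fun_mul hb)).fun_div hK hK0).fun_neg.congr_deriv ?_
  field_simp
  push_cast
  ring

/-- This function is `Γ^t_{ti}`, and it enters `Γ^φ_{φi}` with the opposite sign. Its derivative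
cancels from the Ricci tensor, so only the existence of that derivative matters. -/
theorem differentiableAt_christoffel_trace (hr : HasDerivAt r r' s) (hr0 : r s ≠ 0)
    (hu : HasDerivAt u u' s) (hA : HasDerivAt A A' s)
    (hv : HasDerivAt v v' s) (hb : HasDerivAt b b' s) :
    ∃ S, HasDerivAt (fun s => v s + Real.exp (2 * u s) ^ 2 * A s * b s / (2 * r s ^ 2)) S s := by
  have hE := ((hu.const_mul 2).exp).fun_pow 2
  exact ⟨_, hv.fun_add (((hE.fun_mul hA).fun_mul hb).fun_div ((hr.fun_pow 2).const_mul 2)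
    (by positivity))⟩

end CurveDerivatives

/-- The table is valid on an open set, hence may be differentiated there. `T` is a freely chosen
form of the table entry that fits the available derivative formulas. -/
theorem pderiv_christoffel {D : Set (ℝ × ℝ)} (hDo : IsOpen D) (hD0 : ∀ q ∈ D, q.1 ≠ 0)
    {U a k U₁ U₂ a₁ a₂ k₁ k₂ : ℝ → ℝ → ℝ}
    (hU : HasPartialsOn D U U₁ U₂) (ha : HasPartialsOn D a a₁ a₂) (hk : HasPartialsOn D k k₁ k₂)
    {p : Fin 4 → ℝ} (hp : (p 1, p 2) ∈ D) (c i j : Fin 4) {T : ℝ → ℝ → ℝ}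
    (hT : ∀ r z, christoffelTable r (Real.exp (2 * U r z)) (a r z)
        (Real.exp (2 * k r z)) (U₁ r z) (U₂ r z) (a₁ r z) (a₂ r z) (k₁ r z) (k₂ r z) c i j
        = T r z) :
    pderiv 0 (christoffel (weylMetric U a k) c i j) p = 0 ∧
    pderiv 3 (christoffel (weylMetric U a k) c i j) p = 0 ∧
    (∀ d, HasDerivAt (fun r => T r (p 2)) d (p 1) →
      pderiv 1 (christoffel (weylMetric U a k) c i j) p = d) ∧
    (∀ d, HasDerivAt (fun z => T (p 1) z) d (p 2) →
      pderiv 2 (christoffel (weylMetric U a k) c i j) p = d) := by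
  have hval : ∀ q : Fin 4 → ℝ, (q 1, q 2) ∈ D →
      christoffel (weylMetric U a k) c i j q = T (q 1) (q 2) := fun q hq =>
    (christoffel_weylMetric hU ha hk hq (hD0 _ hq) c i j).trans (hT _ _)
  refine ⟨?_, ?_, fun d hd => ?_, fun d hd => ?_⟩
  · refine ((hasDerivAt_const (p 0) (T (p 1) (p 2))).congr_of_eventuallyEq
      (Filter.Eventually.of_forall fun s => ?_)).deriv
    simpa using hval (Function.update p 0 s) (by simpa using hp)
  · refine ((hasDerivAt_const (p 3) (T (p 1) (p 2))).congr_of_eventuallyEq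
      (Filter.Eventually.of_forall fun s => ?_)).deriv
    simpa using hval (Function.update p 3 s) (by simpa using hp)
  · refine (hd.congr_of_eventuallyEq ?_).deriv
    have : ∀ᶠ s in 𝓝 (p 1), (s, p 2) ∈ D :=
      (by fun_prop : ContinuousAt (fun s => (s, p 2)) (p 1)).eventually (hDo.mem_nhds hp)
    filter_upwards [this] with s hs
    simpa using hval (Function.update p 1 s) (by simpa using hs)
  · refine (hd.congr_of_eventuallyEq ?_).deriv
    have : ∀ᶠ s in 𝓝 (p 2), (p 1, s) ∈ D :=
      (by fun_prop : ContinuousAt (fun s => (p 1, s)) (p 2)).eventually (hDo.mem_nhds hp)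
    filter_upwards [this] with s hs
    simpa using hval (Function.update p 2 s) (by simpa using hs)

/-- The values of all functions at `p` are replaced by free variables, which reduces each component
to an identity between rational functions. `X` and `Y` are the differential operators of the field
equations for `U` and `a`. -/
theorem ricci_weylMetric {D : Set (ℝ × ℝ)} (hDo : IsOpen D) (hD0 : ∀ q ∈ D, q.1 ≠ 0)
    {U a k U₁ U₂ a₁ a₂ k₁ k₂ U₁₁ U₁₂ U₂₂ a₁₁ a₁₂ a₂₂ k₁₁ k₁₂ k₂₂ : ℝ → ℝ → ℝ}
    (hU : HasPartialsOn D U U₁ U₂) (ha : HasPartialsOn D a a₁ a₂) (hk : HasPartialsOn D k k₁ k₂)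
    (hU₁ : HasPartialsOn D U₁ U₁₁ U₁₂) (hU₂ : HasPartialsOn D U₂ U₁₂ U₂₂)
    (ha₁ : HasPartialsOn D a₁ a₁₁ a₁₂) (ha₂ : HasPartialsOn D a₂ a₁₂ a₂₂)
    (hk₁ : HasPartialsOn D k₁ k₁₁ k₁₂) (hk₂ : HasPartialsOn D k₂ k₁₂ k₂₂)
    {p : Fin 4 → ℝ} (hp : (p 1, p 2) ∈ D)
    {r E A K u₁ u₂ b₁ b₂ c₁ c₂ u₁₁ u₁₂ u₂₂ b₁₁ b₂₂ c₁₁ c₂₂ X Y : ℝ} (hr : p 1 = r)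
    (hE : Real.exp (2 * U (p 1) (p 2)) = E) (hA : a (p 1) (p 2) = A)
    (hK : Real.exp (2 * k (p 1) (p 2)) = K) (hu₁ : U₁ (p 1) (p 2) = u₁)
    (hu₂ : U₂ (p 1) (p 2) = u₂) (hb₁ : a₁ (p 1) (p 2) = b₁) (hb₂ : a₂ (p 1) (p 2) = b₂)
    (hc₁ : k₁ (p 1) (p 2) = c₁) (hc₂ : k₂ (p 1) (p 2) = c₂) (hu₁₁ : U₁₁ (p 1) (p 2) = u₁₁)
    (hu₁₂ : U₁₂ (p 1) (p 2) = u₁₂)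
    (hu₂₂ : U₂₂ (p 1) (p 2) = u₂₂) (hb₁₁ : a₁₁ (p 1) (p 2) = b₁₁) (hb₂₂ : a₂₂ (p 1) (p 2) = b₂₂)
    (hc₁₁ : k₁₁ (p 1) (p 2) = c₁₁) (hc₂₂ : k₂₂ (p 1) (p 2) = c₂₂)
    (hX : X = u₁₁ + u₂₂ + u₁ / r + E ^ 2 / (2 * r ^ 2) * (b₁ ^ 2 + b₂ ^ 2))
    (hY : Y = b₁₁ + b₂₂ - b₁ / r + 4 * (u₁ * b₁ + u₂ * b₂)) :
    ricci (weylMetric U a k) 0 0 p = E ^ 2 / K * X ∧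
    ricci (weylMetric U a k) 0 3 p = E ^ 2 / K * (A * X + Y / 2) ∧
    ricci (weylMetric U a k) 3 3 p = E ^ 2 / K * (A ^ 2 * X + A * Y + r ^ 2 / E ^ 2 * X) ∧
    ricci (weylMetric U a k) 1 1 p = u₁₁ + u₂₂ + u₁ / r - c₁₁ - c₂₂ + c₁ / r - 2 * u₁ ^ 2
      + E ^ 2 / (2 * r ^ 2) * b₁ ^ 2 ∧
    ricci (weylMetric U a k) 2 2 p = u₁₁ + u₂₂ + u₁ / r - c₁₁ - c₂₂ - c₁ / r - 2 * u₂ ^ 2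
      + E ^ 2 / (2 * r ^ 2) * b₂ ^ 2 ∧
    ricci (weylMetric U a k) 1 2 p = c₂ / r - 2 * u₁ * u₂ + E ^ 2 / (2 * r ^ 2) * (b₁ * b₂) := by
  subst hr
  have hr0 : p 1 ≠ 0 := hD0 _ hp
  have hΓ := fun c i j => christoffel_weylMetric hU ha hk hp hr0 c i j
  have d0 := fun c i j => (pderiv_christoffel hDo hD0 hU ha hk hp c i j (fun _ _ => rfl)).1
  have d3 := fun c i j => (pderiv_christoffel hDo hD0 hU ha hk hp c i j (fun _ _ => rfl)).2.1
  have h1 := fun c i j (T : ℝ → ℝ → ℝ) hT =>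
    (pderiv_christoffel hDo hD0 hU ha hk hp c i j (T := T) hT).2.2.1
  have h2 := fun c i j (T : ℝ → ℝ → ℝ) hT =>
    (pderiv_christoffel hDo hD0 hU ha hk hp c i j (T := T) hT).2.2.2
  obtain ⟨S11, hS11⟩ := differentiableAt_christoffel_trace (hasDerivAt_id' (p 1)) hr0
    (hU.fst _ hp) (ha.fst _ hp) (hU₁.fst _ hp) (ha₁.fst _ hp)
  obtain ⟨S12, hS12⟩ := differentiableAt_christoffel_trace (hasDerivAt_const (p 2) (p 1)) hr0
    (hU.snd _ hp) (ha.snd _ hp) (hU₁.snd _ hp) (ha₁.snd _ hp)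
  obtain ⟨S22, hS22⟩ := differentiableAt_christoffel_trace (hasDerivAt_const (p 2) (p 1)) hr0
    (hU.snd _ hp) (ha.snd _ hp) (hU₂.snd _ hp) (ha₂.snd _ hp)
  have e100 := h1 1 0 0 _ (fun _ _ => rfl) _
    (hasDerivAt_christoffel_tt (hU.fst _ hp) (hk.fst _ hp) (hU₁.fst _ hp))
  have e200 := h2 2 0 0 _ (fun _ _ => rfl) _
    (hasDerivAt_christoffel_tt (hU.snd _ hp) (hk.snd _ hp) (hU₂.snd _ hp))
  have e103 := h1 1 0 3 _ (fun _ _ => rfl) _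
    (hasDerivAt_christoffel_tphi (hU.fst _ hp) (ha.fst _ hp) (hk.fst _ hp) (hU₁.fst _ hp)
      (ha₁.fst _ hp))
  have e203 := h2 2 0 3 _ (fun _ _ => rfl) _
    (hasDerivAt_christoffel_tphi (hU.snd _ hp) (ha.snd _ hp) (hk.snd _ hp) (hU₂.snd _ hp)
      (ha₂.snd _ hp))
  have e133 := h1 1 3 3 _ (fun _ _ => rfl) _
    (hasDerivAt_christoffel_phiphi (hasDerivAt_id' (p 1)) (hU.fst _ hp) (ha.fst _ hp)
      (hk.fst _ hp) (hU₁.fst _ hp) (ha₁.fst _ hp) (hasDerivAt_id' (p 1)))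
  have e233 := h2 2 3 3 (fun r z => -((0 - r ^ 2 * U₂ r z
      - Real.exp (2 * U r z) ^ 2 * U₂ r z * a r z ^ 2
      - Real.exp (2 * U r z) ^ 2 * a r z * a₂ r z) / Real.exp (2 * k r z)))
    (fun r z => by simp [christoffelTable]) _
    (hasDerivAt_christoffel_phiphi (hasDerivAt_const (p 2) (p 1)) (hU.snd _ hp) (ha.snd _ hp)
      (hk.snd _ hp) (hU₂.snd _ hp) (ha₂.snd _ hp) (hasDerivAt_const (p 2) 0))
  have L11 := (hk₁.fst _ hp).fun_sub (hU₁.fst _ hp)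
  have L12 := (hk₁.snd _ hp).fun_sub (hU₁.snd _ hp)
  have L21 := (hk₂.fst _ hp).fun_sub (hU₂.fst _ hp)
  have L22 := (hk₂.snd _ hp).fun_sub (hU₂.snd _ hp)
  have hinv1 := (hasDerivAt_const (p 1) (1 : ℝ)).fun_div (hasDerivAt_id' (p 1)) hr0
  have e1_111 := h1 1 1 1 _ (fun _ _ => rfl) _ L11
  have e2_111 := h2 1 1 1 _ (fun _ _ => rfl) _ L12
  have e1_112 := h1 1 1 2 _ (fun _ _ => rfl) _ L21
  have e2_121 := h2 1 2 1 _ (fun _ _ => rfl) _ L22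
  have e1_122 := h1 1 2 2 _ (fun _ _ => rfl) _ L11.fun_neg
  have e2_211 := h2 2 1 1 _ (fun _ _ => rfl) _ L22.fun_neg
  have e1_212 := h1 2 1 2 _ (fun _ _ => rfl) _ L11
  have e2_212 := h2 2 1 2 _ (fun _ _ => rfl) _ L12
  have e2_222 := h2 2 2 2 _ (fun _ _ => rfl) _ L22
  have e1_010 := h1 0 1 0 _ (fun _ _ => rfl) _ hS11
  have e2_010 := h2 0 1 0 _ (fun _ _ => rfl) _ hS12
  have e2_020 := h2 0 2 0 _ (fun _ _ => rfl) _ hS22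
  have e1_313 := h1 3 1 3 _ (fun _ _ => rfl) _ (hinv1.fun_sub hS11)
  have e2_313 := h2 3 1 3 _ (fun _ _ => rfl) _
    ((hasDerivAt_const (p 2) (1 / p 1)).fun_sub hS12)
  have e2_323 := h2 3 2 3 _ (fun _ _ => rfl) _ hS22.fun_neg
  have hE0 : E ≠ 0 := hE ▸ (Real.exp_pos _).ne'
  have hK0 : K ≠ 0 := hK ▸ (Real.exp_pos _).ne'
  simp only [hE, hA, hK, hu₁, hu₂, hb₁, hb₂, hc₁, hc₂] at hΓ
  simp only [hE, hA, hK, hu₁, hu₂, hb₁, hb₂, hc₁, hc₂, hu₁₁, hu₂₂, hb₁₁, hb₂₂]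
    at e100 e200 e103 e203 e133 e233
  simp only [hu₁₁, hu₁₂, hu₂₂, hc₁₁, hc₂₂]
    at e1_111 e2_111 e1_112 e2_121 e1_122 e2_211 e1_212 e2_212 e2_222
  clear h1 h2 hS11 hS12 hS22 L11 L12 L21 L22 hinv1
  subst hX hY
  refine ⟨?_, ?_, ?_, ?_, ?_, ?_⟩
  · simp [ricci, Fin.sum_univ_four, hΓ, d0, d3, e100, e200, christoffelTable]
    field_simp
    ring
  · simp [ricci, Fin.sum_univ_four, hΓ, d0, d3, e103, e203, christoffelTable]
    field_simp
    ring
  · simp [ricci, Fin.sum_univ_four, hΓ, d0, d3, e133, e233, christoffelTable]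
    field_simp
    ring
  · simp [ricci, Fin.sum_univ_four, hΓ, d0, d3, e1_111, e2_211, e1_212, e1_010, e1_313,
      christoffelTable]
    field_simp
    ring
  · simp [ricci, Fin.sum_univ_four, hΓ, d0, d3, e1_122, e2_222, e2_121, e2_020, e2_323,
      christoffelTable]
    field_simp
    ring
  · simp [ricci, Fin.sum_univ_four, hΓ, d0, d3, e2_111, e1_112, e2_212, e2_010, e2_313,
      christoffelTable]
    field_simp
    ring

/-! ### The field equations of rigidly rotating dust -/

/-- Einstein's equations for dust at rest, solved for the Ricci tensor of the Weyl metric. -/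
theorem ricci_eq_of_einstein {U a k μ : ℝ → ℝ → ℝ} {p : Fin 4 → ℝ} (hr0 : p 1 ≠ 0)
    (h : EinsteinEquationsAt (weylMetric U a k) (dustStress U μ) p)
    {E A K m : ℝ} (hE : Real.exp (2 * U (p 1) (p 2)) = E) (hA : a (p 1) (p 2) = A)
    (hK : Real.exp (2 * k (p 1) (p 2)) = K) (hm : μ (p 1) (p 2) = m) :
    ricci (weylMetric U a k) 0 0 p = 4 * Real.pi * m * E ∧
    ricci (weylMetric U a k) 0 3 p = 4 * Real.pi * m * (E * A) ∧
    ricci (weylMetric U a k) 1 1 p = 4 * Real.pi * m * (K / E) ∧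
    ricci (weylMetric U a k) 2 2 p = 4 * Real.pi * m * (K / E) ∧
    ricci (weylMetric U a k) 1 2 p = 0 := by
  have hE0 : E ≠ 0 := hE ▸ (Real.exp_pos _).ne'
  have hK0 : K ≠ 0 := hK ▸ (Real.exp_pos _).ne'
  have hginv : (weylMetric U a k p)⁻¹ =
      !![-E⁻¹ + E * A ^ 2 / p 1 ^ 2, 0, 0, -(E * A / p 1 ^ 2); 0, E / K, 0, 0; 0, 0, E / K, 0;
        -(E * A / p 1 ^ 2), 0, 0, E / p 1 ^ 2] := by
    rw [weylMetric_eq, weylComponents_inv hr0, hE, hA, hK]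
  have hg : weylMetric U a k p = !![-E, 0, 0, -(E * A); 0, E⁻¹ * K, 0, 0; 0, 0, E⁻¹ * K, 0;
      -(E * A), 0, 0, E⁻¹ * p 1 ^ 2 - E * A ^ 2] := by
    rw [weylMetric_eq, weylComponents, exp_neg_two_mul, hE, hA, hK]
  have hT : ∀ c d, dustStress U μ p c d = if c = 0 ∧ d = 0 then m * E⁻¹ else 0 := by
    intro c d
    rw [dustStress, exp_neg_two_mul, hE, hm]
  have hR : scalarCurvature (weylMetric U a k) p
      = ∑ i, ∑ j, (weylMetric U a k p)⁻¹ i j * ricci (weylMetric U a k) i j p := rfl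
  rw [hginv] at hR
  have h00 := h 0 0
  have h03 := h 0 3
  have h30 := h 3 0
  have h33 := h 3 3
  have h11 := h 1 1
  have h22 := h 2 2
  have h12 := h 1 2
  simp only [einstein] at h00 h03 h30 h33 h11 h22 h12
  generalize scalarCurvature (weylMetric U a k) p = S at *
  rw [hg] at h00 h03 h30 h33 h11 h22 h12
  simp [Fin.sum_univ_four, hT] at h00 h03 h30 h33 h11 h22 h12 hR
  generalize ricci (weylMetric U a k) 0 0 p = R00 at *
  generalize ricci (weylMetric U a k) 0 3 p = R03 at *
  generalize ricci (weylMetric U a k) 3 0 p = R30 at *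
  generalize ricci (weylMetric U a k) 3 3 p = R33 at *
  generalize ricci (weylMetric U a k) 1 1 p = R11 at *
  generalize ricci (weylMetric U a k) 2 2 p = R22 at *
  have g00 : R00 = 8 * Real.pi * m * E - S * E / 2 := by
    field_simp at h00 ⊢; linarith
  have g03 : R03 = 8 * Real.pi * m * (E * A) - S * (E * A) / 2 := by
    field_simp at h03 ⊢; linarith
  have g30 : R30 = 8 * Real.pi * m * (E * A) - S * (E * A) / 2 := by
    field_simp at h30 ⊢; linarith
  have g33 : R33 = 8 * Real.pi * m * (E * A ^ 2) + S * (p 1 ^ 2 / E - E * A ^ 2) / 2 := by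
    field_simp at h33 ⊢; linarith
  have g11 : R11 = S * (K / E) / 2 := by field_simp at h11 ⊢; linarith
  have g22 : R22 = S * (K / E) / 2 := by field_simp at h22 ⊢; linarith
  -- The trace of Einstein's equations: the trace of the dust tensor is `-μ`, so the scalar
  -- curvature is `8πμ`.
  have hS : S = 8 * Real.pi * m := by
    rw [g00, g03, g30, g33, g11, g22] at hR
    field_simp at hR
    have : p 1 ^ 2 * (S - 8 * Real.pi * m) = 0 := by linear_combination -1 / 2 * hR
    linarith [(mul_eq_zero.1 this).resolve_left (by positivity)]
  refine ⟨?_, ?_, ?_, ?_, h12⟩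
  · rw [g00, hS]; ring
  · rw [g03, hS]; ring
  · rw [g11, hS]; ring
  · rw [g22, hS]; ring

/-- The field equations of rigidly rotating dust at a point off the axis. -/
theorem field_equations {D : Set (ℝ × ℝ)} (hDo : IsOpen D) (hD0 : ∀ q ∈ D, q.1 ≠ 0)
    {U a k μ U₁ U₂ a₁ a₂ k₁ k₂ U₁₁ U₁₂ U₂₂ a₁₁ a₁₂ a₂₂ k₁₁ k₁₂ k₂₂ : ℝ → ℝ → ℝ}
    (hU : HasPartialsOn D U U₁ U₂) (ha : HasPartialsOn D a a₁ a₂) (hk : HasPartialsOn D k k₁ k₂)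
    (hU₁ : HasPartialsOn D U₁ U₁₁ U₁₂) (hU₂ : HasPartialsOn D U₂ U₁₂ U₂₂)
    (ha₁ : HasPartialsOn D a₁ a₁₁ a₁₂) (ha₂ : HasPartialsOn D a₂ a₁₂ a₂₂)
    (hk₁ : HasPartialsOn D k₁ k₁₁ k₁₂) (hk₂ : HasPartialsOn D k₂ k₁₂ k₂₂)
    {r z : ℝ} (hp : (r, z) ∈ D)
    (h : EinsteinEquationsAt (weylMetric U a k) (dustStress U μ) ![0, r, z, 0]) :
    k₁ r z = r * (U₁ r z ^ 2 - U₂ r z ^ 2)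
      - Real.exp (2 * U r z) ^ 2 * (a₁ r z ^ 2 - a₂ r z ^ 2) / (4 * r) ∧
    k₂ r z = 2 * r * (U₁ r z * U₂ r z)
      - Real.exp (2 * U r z) ^ 2 * (a₁ r z * a₂ r z) / (2 * r) ∧
    U₁₁ r z + U₂₂ r z + U₁ r z / r
      + Real.exp (2 * U r z) ^ 2 / (2 * r ^ 2) * (a₁ r z ^ 2 + a₂ r z ^ 2)
      = 4 * Real.pi * μ r z * (Real.exp (2 * k r z) / Real.exp (2 * U r z)) ∧
    a₁₁ r z + a₂₂ r z - a₁ r z / r + 4 * (U₁ r z * a₁ r z + U₂ r z * a₂ r z) = 0 ∧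
    k₁₁ r z + k₂₂ r z = U₁₁ r z + U₂₂ r z + U₁ r z / r - (U₁ r z ^ 2 + U₂ r z ^ 2)
      + Real.exp (2 * U r z) ^ 2 / (4 * r ^ 2) * (a₁ r z ^ 2 + a₂ r z ^ 2)
      - 4 * Real.pi * μ r z * (Real.exp (2 * k r z) / Real.exp (2 * U r z)) := by
  have hr0 : r ≠ 0 := hD0 _ hp
  obtain ⟨r00, r03, -, r11, r22, r12⟩ := ricci_weylMetric hDo hD0 hU ha hk hU₁ hU₂ ha₁ ha₂ hk₁ hk₂
    (p := ![0, r, z, 0]) hp (r := r) rfl rfl rfl rfl rfl rfl rfl rfl rfl rfl rfl rfl rfl rfl rfl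
    rfl rfl rfl rfl
  obtain ⟨s00, s03, s11, s22, s12⟩ := ricci_eq_of_einstein (p := ![0, r, z, 0]) hr0 h rfl rfl
    rfl rfl
  rw [s00] at r00
  rw [s03] at r03
  rw [s11] at r11
  rw [s22] at r22
  rw [s12] at r12
  simp only [Matrix.cons_val] at r00 r03 r11 r22 r12
  have hE0 : Real.exp (2 * U r z) ≠ 0 := (Real.exp_pos _).ne'
  have hK0 : Real.exp (2 * k r z) ≠ 0 := (Real.exp_pos _).ne'
  generalize Real.exp (2 * U r z) = E at *
  generalize Real.exp (2 * k r z) = K at *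
  have hX := r00
  set X := U₁₁ r z + U₂₂ r z + U₁ r z / r + E ^ 2 / (2 * r ^ 2) * (a₁ r z ^ 2 + a₂ r z ^ 2)
    with hXdef
  set Y := a₁₁ r z + a₂₂ r z - a₁ r z / r + 4 * (U₁ r z * a₁ r z + U₂ r z * a₂ r z)
  have e3 : X = 4 * Real.pi * μ r z * (K / E) := by
    field_simp at hX ⊢
    linarith
  have e4 : Y = 0 := by
    rw [mul_add, show E ^ 2 / K * (a r z * X) = a r z * (E ^ 2 / K * X) by ring, ← r00] at r03
    have : E ^ 2 / K * (Y / 2) = 0 := by linarith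
    rcases mul_eq_zero.1 this with h0 | h0
    · exact absurd h0 (by positivity)
    · linarith
  -- The difference of `R_ρρ` and `R_ζζ` contains no second derivatives and gives `k_ρ`; `R_ρζ`
  -- gives `k_ζ`; the mean of `R_ρρ` and `R_ζζ` gives `k_ρρ + k_ζζ`.
  refine ⟨?_, ?_, e3, e4, ?_⟩
  · have hd : 2 * (k₁ r z / r) = 2 * U₁ r z ^ 2 - 2 * U₂ r z ^ 2
        - E ^ 2 / (2 * r ^ 2) * (a₁ r z ^ 2 - a₂ r z ^ 2) := by linarith
    field_simp at hd ⊢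
    linarith
  · field_simp at r12 ⊢
    linarith
  · have hs : E ^ 2 / (4 * r ^ 2) * (a₁ r z ^ 2 + a₂ r z ^ 2)
        = (E ^ 2 / (2 * r ^ 2) * a₁ r z ^ 2 + E ^ 2 / (2 * r ^ 2) * a₂ r z ^ 2) / 2 := by ring
    rw [hs]
    linarith

/-- For rigidly rotating dust the gradient of `U` vanishes where the density does not. -/
theorem gradient_eq_zero_of_density_ne_zero {D : Set (ℝ × ℝ)} (hDo : IsOpen D)
    (hD0 : ∀ q ∈ D, q.1 ≠ 0)
    {U a k μ U₁ U₂ a₁ a₂ k₁ k₂ U₁₁ U₁₂ U₂₂ a₁₁ a₁₂ a₂₂ k₁₁ k₁₂ k₂₂ : ℝ → ℝ → ℝ}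
    (hU : HasPartialsOn D U U₁ U₂) (ha : HasPartialsOn D a a₁ a₂) (hk : HasPartialsOn D k k₁ k₂)
    (hU₁ : HasPartialsOn D U₁ U₁₁ U₁₂) (hU₂ : HasPartialsOn D U₂ U₁₂ U₂₂)
    (ha₁ : HasPartialsOn D a₁ a₁₁ a₁₂) (ha₂ : HasPartialsOn D a₂ a₁₂ a₂₂)
    (hk₁ : HasPartialsOn D k₁ k₁₁ k₁₂) (hk₂ : HasPartialsOn D k₂ k₁₂ k₂₂)
    (h : ∀ q ∈ D, EinsteinEquationsAt (weylMetric U a k) (dustStress U μ) ![0, q.1, q.2, 0])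
    {r z : ℝ} (hp : (r, z) ∈ D) (hμ : μ r z ≠ 0) : U₁ r z = 0 ∧ U₂ r z = 0 := by
  have hFE := fun q (hq : q ∈ D) =>
    field_equations hDo hD0 hU ha hk hU₁ hU₂ ha₁ ha₂ hk₁ hk₂ (r := q.1) (z := q.2) hq (h q hq)
  obtain ⟨-, -, e3, e4, e5⟩ := hFE _ hp
  have hr0 : r ≠ 0 := hD0 _ hp
  have hnr : ∀ᶠ s in 𝓝 r, (s, z) ∈ D :=
    (by fun_prop : ContinuousAt (fun s => (s, z)) r).eventually (hDo.mem_nhds hp)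
  have hnz : ∀ᶠ s in 𝓝 z, (r, s) ∈ D :=
    (by fun_prop : ContinuousAt (fun s => (r, s)) z).eventually (hDo.mem_nhds hp)
  have u1 := hU.fst _ hp
  have u2 := hU.snd _ hp
  have u11 := hU₁.fst _ hp
  have u12 := hU₁.snd _ hp
  have u21 := hU₂.fst _ hp
  have u22 := hU₂.snd _ hp
  have a11 := ha₁.fst _ hp
  have a12 := ha₁.snd _ hp
  have a21 := ha₂.fst _ hp
  have a22 := ha₂.snd _ hp
  have E1 := ((u1.const_mul 2).exp).fun_pow 2
  have E2 := ((u2.const_mul 2).exp).fun_pow 2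
  have id1 := hasDerivAt_id' r
  -- The first-order equations for `k` hold in a neighbourhood and can be differentiated, which
  -- expresses all second derivatives of `k` through `U` and `a`.
  have k11 := (hk₁.fst _ hp).unique (HasDerivAt.congr_of_eventuallyEq
    ((id1.fun_mul ((u11.fun_pow 2).fun_sub (u21.fun_pow 2))).fun_sub
      ((E1.fun_mul ((a11.fun_pow 2).fun_sub (a21.fun_pow 2))).fun_div (id1.const_mul 4)
        (by positivity))) (hnr.mono fun s hs => (hFE (s, z) hs).1))
  have k12 := (hk₁.snd _ hp).unique (HasDerivAt.congr_of_eventuallyEq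
    ((((u12.fun_pow 2).fun_sub (u22.fun_pow 2)).const_mul r).fun_sub
      ((E2.fun_mul ((a12.fun_pow 2).fun_sub (a22.fun_pow 2))).div_const (4 * r)))
    (hnz.mono fun s hs => (hFE (r, s) hs).1))
  have k21 := (hk₂.fst _ hp).unique (HasDerivAt.congr_of_eventuallyEq
    (((id1.const_mul 2).fun_mul (u11.fun_mul u21)).fun_sub
      ((E1.fun_mul (a11.fun_mul a21)).fun_div (id1.const_mul 2) (by positivity)))
    (hnr.mono fun s hs => (hFE (s, z) hs).2.1))
  have k22 := (hk₂.snd _ hp).unique (HasDerivAt.congr_of_eventuallyEq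
    (((u12.fun_mul u22).const_mul (2 * r)).fun_sub
      ((E2.fun_mul (a12.fun_mul a22)).div_const (2 * r)))
    (hnz.mono fun s hs => (hFE (r, s) hs).2.1))
  simp only at k11 k12 k21 k22
  have hE0 : Real.exp (2 * U r z) ≠ 0 := (Real.exp_pos _).ne'
  have hK0 : Real.exp (2 * k r z) ≠ 0 := (Real.exp_pos _).ne'
  have hM0 : 4 * Real.pi * μ r z * (Real.exp (2 * k r z) / Real.exp (2 * U r z)) ≠ 0 := by
    have := Real.pi_pos
    positivity
  generalize 4 * Real.pi * μ r z * (Real.exp (2 * k r z) / Real.exp (2 * U r z)) = M at *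
  generalize Real.exp (2 * U r z) = E at *
  generalize Real.exp (2 * k r z) = K at *
  have hmix := k12.symm.trans k21
  rw [k11, k22] at e5
  generalize U₁ r z = x₁ at *
  generalize U₂ r z = x₂ at *
  generalize a₁ r z = y₁ at *
  generalize a₂ r z = y₂ at *
  generalize U₁₁ r z = x₁₁ at *
  generalize U₁₂ r z = x₁₂ at *
  generalize U₂₂ r z = x₂₂ at *
  generalize a₁₁ r z = y₁₁ at *
  generalize a₁₂ r z = y₁₂ at *
  generalize a₂₂ r z = y₂₂ at *
  have f1 : x₁₁ = M - x₂₂ - x₁ / r - E ^ 2 / (2 * r ^ 2) * (y₁ ^ 2 + y₂ ^ 2) := by linarith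
  have f2 : y₁₁ = y₁ / r - y₂₂ - 4 * (x₁ * y₁ + x₂ * y₂) := by linarith
  subst f1 f2
  -- After elimination of `U_ρρ` and `a_ρρ`, the equation for `k_ρρ + k_ζζ` leaves `M U_ρ = 0`, and
  -- equality of the mixed derivatives leaves `M U_ζ = 0`.
  have hA : M * x₁ = 0 := by
    linear_combination (norm := (push_cast; field_simp; ring)) 1 / (2 * r) * e5
  have hB : M * x₂ = 0 := by
    linear_combination (norm := (push_cast; field_simp; ring)) -1 / (2 * r) * hmix
  exact ⟨(mul_eq_zero.1 hA).resolve_left hM0, (mul_eq_zero.1 hB).resolve_left hM0⟩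

/-! ### Twice continuously differentiable axial functions -/

/-- The functions `f₁, …, f₂₂` are the continuous first and second partial derivatives of `f` on
`S`. -/
structure C2PartialsOn (S : Set (ℝ × ℝ)) (f f₁ f₂ f₁₁ f₁₂ f₂₂ : ℝ → ℝ → ℝ) : Prop where
  zeroth : HasPartialsOn S f f₁ f₂
  first : HasPartialsOn S f₁ f₁₁ f₁₂
  second : HasPartialsOn S f₂ f₁₂ f₂₂
  cont : ContinuousOn (fun q : ℝ × ℝ => f q.1 q.2) S
  cont₁ : ContinuousOn (fun q : ℝ × ℝ => f₁ q.1 q.2) S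
  cont₂ : ContinuousOn (fun q : ℝ × ℝ => f₂ q.1 q.2) S
  cont₁₁ : ContinuousOn (fun q : ℝ × ℝ => f₁₁ q.1 q.2) S
  cont₁₂ : ContinuousOn (fun q : ℝ × ℝ => f₁₂ q.1 q.2) S
  cont₂₂ : ContinuousOn (fun q : ℝ × ℝ => f₂₂ q.1 q.2) S

theorem hasDerivAt_fst_slice {G : ℝ × ℝ → ℝ} {G' : ℝ × ℝ →L[ℝ] ℝ} {q : ℝ × ℝ}
    (h : HasFDerivAt G G' q) : HasDerivAt (fun r => G (r, q.2)) (G' (1, 0)) q.1 :=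
  h.comp_hasDerivAt (f := fun r => (r, q.2)) q.1
    ((hasDerivAt_id q.1).prodMk (hasDerivAt_const q.1 q.2))

theorem hasDerivAt_snd_slice {G : ℝ × ℝ → ℝ} {G' : ℝ × ℝ →L[ℝ] ℝ} {q : ℝ × ℝ}
    (h : HasFDerivAt G G' q) : HasDerivAt (fun z => G (q.1, z)) (G' (0, 1)) q.2 :=
  h.comp_hasDerivAt (f := fun z => (q.1, z)) q.2
    ((hasDerivAt_const q.2 q.1).prodMk (hasDerivAt_id q.2))

theorem exists_c2PartialsOn {S : Set (ℝ × ℝ)} (hS : IsOpen S) {f : ℝ → ℝ → ℝ}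
    (hf : ContDiffOn ℝ 2 (fun q : ℝ × ℝ => f q.1 q.2) S) :
    ∃ f₁ f₂ f₁₁ f₁₂ f₂₂, C2PartialsOn S f f₁ f₂ f₁₁ f₁₂ f₂₂ := by
  set G : ℝ × ℝ → ℝ := fun q => f q.1 q.2 with hG
  have hG' : ContDiffOn ℝ 1 (fderiv ℝ G) S := hf.fderiv_of_isOpen hS (by norm_num)
  have hdir : ∀ v : ℝ × ℝ, ContDiffOn ℝ 1 (fun q => fderiv ℝ G q v) S := fun v =>
    hG'.clm_apply contDiffOn_const
  have hdir' : ∀ v w : ℝ × ℝ, ContinuousOn (fun q => fderiv ℝ (fun q => fderiv ℝ G q v) q w) S :=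
    fun v w => ((hdir v).continuousOn_fderiv_of_isOpen hS le_rfl).clm_apply continuousOn_const
  have hd0 : ∀ q ∈ S, HasFDerivAt G (fderiv ℝ G q) q := fun q hq =>
    ((hf.differentiableOn (by norm_num)).differentiableAt (hS.mem_nhds hq)).hasFDerivAt
  have hd1 : ∀ v, ∀ q ∈ S, HasFDerivAt (fun q => fderiv ℝ G q v)
      (fderiv ℝ (fun q => fderiv ℝ G q v) q) q := fun v q hq =>
    (((hdir v).differentiableOn (by norm_num)).differentiableAt (hS.mem_nhds hq)).hasFDerivAt
  have hsymm : ∀ q ∈ S, fderiv ℝ (fun q => fderiv ℝ G q (0, 1)) q (1, 0)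
      = fderiv ℝ (fun q => fderiv ℝ G q (1, 0)) q (0, 1) := by
    intro q hq
    have hdd : DifferentiableAt ℝ (fderiv ℝ G) q :=
      (hG'.differentiableOn (by norm_num)).differentiableAt (hS.mem_nhds hq)
    have hs := ((hf.contDiffAt (hS.mem_nhds hq)).isSymmSndFDerivAt (by simp)).eq (1, 0) (0, 1)
    rw [fderiv_clm_apply hdd (differentiableAt_const _),
      fderiv_clm_apply hdd (differentiableAt_const _)]
    simpa using hs
  refine ⟨fun r z => fderiv ℝ G (r, z) (1, 0), fun r z => fderiv ℝ G (r, z) (0, 1),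
    fun r z => fderiv ℝ (fun q => fderiv ℝ G q (1, 0)) (r, z) (1, 0),
    fun r z => fderiv ℝ (fun q => fderiv ℝ G q (1, 0)) (r, z) (0, 1),
    fun r z => fderiv ℝ (fun q => fderiv ℝ G q (0, 1)) (r, z) (0, 1),
    ⟨fun q hq => hasDerivAt_fst_slice (hd0 q hq),
      fun q hq => hasDerivAt_snd_slice (hd0 q hq)⟩,
    ⟨fun q hq => hasDerivAt_fst_slice (hd1 (1, 0) q hq),
      fun q hq => hasDerivAt_snd_slice (hd1 (1, 0) q hq)⟩,
    ⟨fun q hq => ?_, fun q hq => hasDerivAt_snd_slice (hd1 (0, 1) q hq)⟩,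
    hf.continuousOn, (hdir (1, 0)).continuousOn, (hdir (0, 1)).continuousOn, hdir' _ _, hdir' _ _,
    hdir' _ _⟩
  have := hasDerivAt_fst_slice (hd1 (0, 1) q hq)
  rwa [hsymm q hq] at this

theorem rho_meridional (r z : ℝ) : rho !₂[r, 0, z] = |r| := by
  simp [rho, Real.sqrt_sq_eq_abs]

theorem axial_meridional (f : ℝ → ℝ → ℝ) (r z : ℝ) : axial f !₂[r, 0, z] = f |r| z := by
  rw [axial, rho_meridional]
  simp [zeta]

theorem meridional_mem_ball_iff {R r z : ℝ} (hR : 0 < R) :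
    (!₂[r, 0, z] : Space) ∈ Metric.ball 0 R ↔ r ^ 2 + z ^ 2 < R ^ 2 := by
  rw [mem_ball_zero_iff, EuclideanSpace.norm_eq, Real.sqrt_lt' hR]
  simp [Fin.sum_univ_three]

theorem meridional_mem_ball {R r z : ℝ} (h : (r, z) ∈ square R) :
    (!₂[r, 0, z] : Space) ∈ Metric.ball 0 (2 * R) := by
  have hr : |r| < R := abs_lt.2 h.1
  have hz : |z| < R := abs_lt.2 h.2
  have hR : 0 < R := (abs_nonneg r).trans_lt hr
  rw [meridional_mem_ball_iff (by positivity)]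
  nlinarith [abs_nonneg r, abs_nonneg z, sq_abs r, sq_abs z]

theorem contDiff_meridional : ContDiff ℝ 2 (fun q : ℝ × ℝ => (!₂[q.1, 0, q.2] : Space)) := by
  rw [contDiff_euclidean]
  intro i
  fin_cases i <;> simp <;> fun_prop

/-- Restriction to the plane `y = 0`, where `ρ = |r|`. Regularity in space thus becomes regularity
of the even extension across the axis, which supplies derivatives at `ρ = 0`. -/
theorem contDiffOn_meridional {B : Set Space} {S : Set (ℝ × ℝ)} {f : ℝ → ℝ → ℝ}
    (hf : ContDiffOn ℝ 2 (axial f) B) (hS : ∀ q ∈ S, (!₂[q.1, 0, q.2] : Space) ∈ B) :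
    ContDiffOn ℝ 2 (fun q : ℝ × ℝ => f |q.1| q.2) S :=
  (hf.comp contDiff_meridional.contDiffOn hS).congr fun q _ => (axial_meridional f q.1 q.2).symm

/-- The part of the square off the axis in the half-plane `ρ > 0`. -/
def halfSquare (R : ℝ) : Set (ℝ × ℝ) := Set.Ioo 0 R ×ˢ Set.Ioo (-R) R

theorem isOpen_halfSquare (R : ℝ) : IsOpen (halfSquare R) := isOpen_Ioo.prod isOpen_Ioo

theorem halfSquare_subset_square (R : ℝ) : halfSquare R ⊆ square R := fun _ hq =>
  ⟨⟨by linarith [hq.1.1, hq.1.2], hq.1.2⟩, hq.2⟩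

theorem HasPartialsOn.mono {S T : Set (ℝ × ℝ)} {f f₁ f₂ : ℝ → ℝ → ℝ} (h : HasPartialsOn S f f₁ f₂)
    (hT : T ⊆ S) : HasPartialsOn T f f₁ f₂ :=
  ⟨fun q hq => h.fst q (hT hq), fun q hq => h.snd q (hT hq)⟩

theorem HasPartialsOn.of_abs {R : ℝ} {f f₁ f₂ : ℝ → ℝ → ℝ}
    (h : HasPartialsOn (square R) (fun r z => f |r| z) f₁ f₂) :
    HasPartialsOn (halfSquare R) f f₁ f₂ := by
  refine ⟨fun q hq => ?_, fun q hq => ?_⟩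
  · refine (h.fst q (halfSquare_subset_square R hq)).congr_of_eventuallyEq ?_
    filter_upwards [Ioi_mem_nhds hq.1.1] with r hr
    rw [abs_of_pos hr]
  · have := h.snd q (halfSquare_subset_square R hq)
    rwa [abs_of_pos hq.1.1] at this

theorem HasPartialsOn.unique {S : Set (ℝ × ℝ)} (hS : IsOpen S) {f g f₁ f₂ g₁ g₂ : ℝ → ℝ → ℝ}
    (hf : HasPartialsOn S f f₁ f₂) (hg : HasPartialsOn S g g₁ g₂)
    (h : ∀ q ∈ S, f q.1 q.2 = g q.1 q.2) {q : ℝ × ℝ} (hq : q ∈ S) :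
    f₁ q.1 q.2 = g₁ q.1 q.2 ∧ f₂ q.1 q.2 = g₂ q.1 q.2 := by
  refine ⟨(hf.fst q hq).unique ((hg.fst q hq).congr_of_eventuallyEq ?_),
    (hf.snd q hq).unique ((hg.snd q hq).congr_of_eventuallyEq ?_)⟩
  · have : ∀ᶠ s in 𝓝 q.1, (s, q.2) ∈ S :=
      (by fun_prop : ContinuousAt (fun s => (s, q.2)) q.1).eventually (hS.mem_nhds hq)
    exact this.mono fun s hs => h (s, q.2) hs
  · have : ∀ᶠ s in 𝓝 q.2, (q.1, s) ∈ S :=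
      (by fun_prop : ContinuousAt (fun s => (q.1, s)) q.2).eventually (hS.mem_nhds hq)
    exact this.mono fun s hs => h (q.1, s) hs

theorem neg_mem_square {R r z : ℝ} (h : (r, z) ∈ square R) : (-r, z) ∈ square R :=
  ⟨⟨by linarith [h.1.2], by linarith [h.1.1]⟩, h.2⟩

/-- Reflection at the axis. -/
theorem HasPartialsOn.reflect {R : ℝ} {f f₁ f₂ : ℝ → ℝ → ℝ}
    (h : HasPartialsOn (square R) f f₁ f₂) :
    HasPartialsOn (square R) (fun r z => f (-r) z) (fun r z => -f₁ (-r) z)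
      (fun r z => f₂ (-r) z) := by
  refine ⟨fun q hq => ?_, fun q hq => h.snd (-q.1, q.2) (neg_mem_square hq)⟩
  have := (h.fst (-q.1, q.2) (neg_mem_square hq)).comp q.1 (hasDerivAt_neg q.1)
  rw [mul_neg_one] at this
  exact this

theorem HasPartialsOn.neg {S : Set (ℝ × ℝ)} {f f₁ f₂ : ℝ → ℝ → ℝ}
    (h : HasPartialsOn S f f₁ f₂) :
    HasPartialsOn S (fun r z => -f r z) (fun r z => -f₁ r z) (fun r z => -f₂ r z) :=
  ⟨fun q hq => (h.fst q hq).neg, fun q hq => (h.snd q hq).neg⟩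

theorem HasPartialsOn.zero (S : Set (ℝ × ℝ)) (c : ℝ) :
    HasPartialsOn S (fun _ _ => c) (fun _ _ => 0) (fun _ _ => 0) :=
  ⟨fun q _ => hasDerivAt_const q.1 c, fun q _ => hasDerivAt_const q.2 c⟩

section Even

variable {R : ℝ} {f f₁ f₂ f₁₁ f₁₂ f₂₂ : ℝ → ℝ → ℝ}

theorem C2PartialsOn.even_odd (h : C2PartialsOn (square R) f f₁ f₂ f₁₁ f₁₂ f₂₂)
    (heven : ∀ r z, f (-r) z = f r z) {q : ℝ × ℝ} (hq : q ∈ square R) :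
    f₁ (-q.1) q.2 = -f₁ q.1 q.2 ∧ f₂ (-q.1) q.2 = f₂ q.1 q.2 ∧
    f₁₁ (-q.1) q.2 = f₁₁ q.1 q.2 ∧ f₂₂ (-q.1) q.2 = f₂₂ q.1 q.2 := by
  have h0 := fun q hq => HasPartialsOn.unique (isOpen_square R) h.zeroth h.zeroth.reflect
    (fun q _ => (heven q.1 q.2).symm) (q := q) hq
  have h1 := HasPartialsOn.unique (isOpen_square R) h.first h.first.reflect.neg
    (fun q hq => (h0 q hq).1) hq
  have h2 := HasPartialsOn.unique (isOpen_square R) h.second h.second.reflect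
    (fun q hq => (h0 q hq).2) hq
  refine ⟨?_, (h0 q hq).2.symm, ?_, h2.2.symm⟩
  · linarith [(h0 q hq).1]
  · linarith [h1.1]

theorem C2PartialsOn.fst_axis (h : C2PartialsOn (square R) f f₁ f₂ f₁₁ f₁₂ f₂₂)
    (heven : ∀ r z, f (-r) z = f r z) {z : ℝ} (hz : z ∈ Set.Ioo (-R) R) : f₁ 0 z = 0 := by
  have hR : (0 : ℝ) ∈ Set.Ioo (-R) R := by constructor <;> linarith [hz.1, hz.2]
  have := (h.even_odd heven (q := (0, z)) ⟨hR, hz⟩).1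
  simp only [neg_zero] at this
  linarith

end Even

theorem eq_of_hasDerivAt_zero {a b : ℝ} {f : ℝ → ℝ} (h : ∀ x ∈ Set.Ioo a b, HasDerivAt f 0 x)
    {x y : ℝ} (hx : x ∈ Set.Ioo a b) (hy : y ∈ Set.Ioo a b) : f x = f y := by
  have := Convex.norm_image_sub_le_of_norm_hasDerivWithin_le (f := f) (f' := fun _ => (0 : ℝ))
    (C := 0) (fun x hx => (h x hx).hasDerivWithinAt) (fun _ _ => by simp) (convex_Ioo a b) hy hx
  rw [zero_mul, norm_le_zero_iff, sub_eq_zero] at this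
  exact this

theorem HasPartialsOn.exists_const {R : ℝ} {f f₁ f₂ : ℝ → ℝ → ℝ}
    (h : HasPartialsOn (halfSquare R) f f₁ f₂)
    (h₁ : ∀ q ∈ halfSquare R, f₁ q.1 q.2 = 0) (h₂ : ∀ q ∈ halfSquare R, f₂ q.1 q.2 = 0) :
    ∃ c, ∀ q ∈ halfSquare R, f q.1 q.2 = c := by
  refine ⟨f (R / 2) 0, fun q hq => ?_⟩
  have hR : 0 < R := hq.1.1.trans hq.1.2
  have hm : R / 2 ∈ Set.Ioo 0 R := ⟨by linarith, by linarith⟩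
  have h0 : (0 : ℝ) ∈ Set.Ioo (-R) R := ⟨by linarith, hR⟩
  calc f q.1 q.2 = f (R / 2) q.2 := eq_of_hasDerivAt_zero (f := fun r => f r q.2) (a := 0) (b := R)
        (fun r hr => by
          have := h.fst (r, q.2) ⟨hr, hq.2⟩
          rwa [h₁ (r, q.2) ⟨hr, hq.2⟩] at this) hq.1 hm
    _ = f (R / 2) 0 := eq_of_hasDerivAt_zero (f := fun z => f (R / 2) z) (a := -R) (b := R)
        (fun z hz => by
          have := h.snd (R / 2, z) ⟨hm, hz⟩
          rwa [h₂ (R / 2, z) ⟨hm, hz⟩] at this) hq.2 h0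

/-- The limit at the axis of a function which is continuous on the square. -/
theorem tendsto_axis {R : ℝ} {f : ℝ → ℝ → ℝ}
    (hf : ContinuousOn (fun q : ℝ × ℝ => f q.1 q.2) (square R)) {z : ℝ}
    (hz : z ∈ Set.Ioo (-R) R) : Filter.Tendsto (fun r => f r z) (𝓝[>] 0) (𝓝 (f 0 z)) := by
  have hR : (0 : ℝ) ∈ Set.Ioo (-R) R := by constructor <;> linarith [hz.1, hz.2]
  have h1 := hf.continuousAt ((isOpen_square R).mem_nhds (show ((0 : ℝ), z) ∈ square R from ⟨hR, hz⟩))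
  have h2 : ContinuousAt (fun r : ℝ => (r, z)) 0 := by fun_prop
  exact tendsto_nhdsWithin_of_tendsto_nhds (h1.tendsto.comp h2.tendsto)

/-! ### Rigidly rotating dust with constant density on the axis -/

theorem halfSquare_fst_ne_zero {R : ℝ} : ∀ q ∈ halfSquare R, q.1 ≠ 0 := fun _ hq => hq.1.1.ne'

/-- The squared gradient of the norm of the axial Killing vector, where `∇U = 0`. -/
theorem gradSq_axialNorm {D : Set (ℝ × ℝ)} {U a k U₁ U₂ a₁ a₂ k₁ k₂ : ℝ → ℝ → ℝ}
    (hU : HasPartialsOn D U U₁ U₂) (ha : HasPartialsOn D a a₁ a₂) (hk : HasPartialsOn D k k₁ k₂)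
    {p : Fin 4 → ℝ} (hp : (p 1, p 2) ∈ D) (hr : p 1 ≠ 0) (h₁ : U₁ (p 1) (p 2) = 0)
    (h₂ : U₂ (p 1) (p 2) = 0) {E K : ℝ} (hE : Real.exp (2 * U (p 1) (p 2)) = E)
    (hK : Real.exp (2 * k (p 1) (p 2)) = K) :
    gradSq (weylMetric U a k) (axialNorm (weylMetric U a k)) p =
      E / K * ((2 * p 1 / E - 2 * E * a (p 1) (p 2) * a₁ (p 1) (p 2)) ^ 2
        + (2 * E * a (p 1) (p 2) * a₂ (p 1) (p 2)) ^ 2) := by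
  obtain ⟨d0, d1, d2, d3⟩ := pderiv_weylMetric hU ha hk hp 3 3
  change pderiv 0 (axialNorm (weylMetric U a k)) p = _ at d0
  change pderiv 1 (axialNorm (weylMetric U a k)) p = _ at d1
  change pderiv 2 (axialNorm (weylMetric U a k)) p = _ at d2
  change pderiv 3 (axialNorm (weylMetric U a k)) p = _ at d3
  rw [gradSq, weylMetric_eq, weylComponents_inv hr, hE, hK]
  rw [hE, hK, h₁] at d1
  rw [hE, hK, h₂] at d2
  simp [Fin.sum_univ_four, d0, d1, d2, d3, weylDeriv]
  ring

theorem axialNorm_weylMetric {U a k : ℝ → ℝ → ℝ} {p : Fin 4 → ℝ} {E : ℝ}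
    (hE : Real.exp (2 * U (p 1) (p 2)) = E) :
    axialNorm (weylMetric U a k) p = p 1 ^ 2 / E - E * a (p 1) (p 2) ^ 2 := by
  have : axialNorm (weylMetric U a k) p = Real.exp (-2 * U (p 1) (p 2)) * p 1 ^ 2
    - Real.exp (2 * U (p 1) (p 2)) * a (p 1) (p 2) ^ 2 := rfl
  rw [this, exp_neg_two_mul, hE]
  ring

/-- The gradient vanishes only off the axis, where the field equations hold; continuity carries the
constant over to the axis. -/
theorem const_U_of_dust {R : ℝ} (hR : 0 < R) {U a k μ : ℝ → ℝ → ℝ}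
    {U₁ U₂ U₁₁ U₁₂ U₂₂ a₁ a₂ a₁₁ a₁₂ a₂₂ k₁ k₂ k₁₁ k₁₂ k₂₂ : ℝ → ℝ → ℝ}
    (cU : C2PartialsOn (square R) (fun r z => U |r| z) U₁ U₂ U₁₁ U₁₂ U₂₂)
    (ca : C2PartialsOn (square R) (fun r z => a |r| z) a₁ a₂ a₁₁ a₁₂ a₂₂)
    (ck : C2PartialsOn (square R) (fun r z => k |r| z) k₁ k₂ k₁₁ k₁₂ k₂₂)
    (hμ : ∀ q ∈ halfSquare R, μ q.1 q.2 ≠ 0)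
    (hEin : ∀ q ∈ halfSquare R,
      EinsteinEquationsAt (weylMetric U a k) (dustStress U μ) ![0, q.1, q.2, 0]) :
    ∃ U₀, (∀ q ∈ halfSquare R, U q.1 q.2 = U₀) ∧ (∀ z ∈ Set.Ioo (-R) R, U 0 z = U₀) ∧
      ∀ q ∈ halfSquare R, U₁ q.1 q.2 = 0 ∧ U₂ q.1 q.2 = 0 := by
  have hH := isOpen_halfSquare R
  have hsub := halfSquare_subset_square R
  have pU := cU.zeroth.of_abs
  have pa := ca.zeroth.of_abs
  have pk := ck.zeroth.of_abs
  have hgrad := fun q (hq : q ∈ halfSquare R) =>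
    gradient_eq_zero_of_density_ne_zero hH halfSquare_fst_ne_zero pU pa pk (cU.first.mono hsub)
      (cU.second.mono hsub) (ca.first.mono hsub) (ca.second.mono hsub) (ck.first.mono hsub)
      (ck.second.mono hsub) hEin (r := q.1) (z := q.2) hq (hμ q hq)
  obtain ⟨U₀, hU₀⟩ := pU.exists_const (fun q hq => (hgrad q hq).1) (fun q hq => (hgrad q hq).2)
  have hUaxis : ∀ z ∈ Set.Ioo (-R) R, U 0 z = U₀ := by
    intro z hz
    have h1 := tendsto_axis (f := fun r z => U |r| z) cU.cont hz
    simp only [abs_zero] at h1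
    refine tendsto_nhds_unique h1 (tendsto_const_nhds.congr' ?_)
    filter_upwards [Ioo_mem_nhdsGT hR] with r hr
    rw [abs_of_pos hr.1, hU₀ (r, z) ⟨hr, hz⟩]
  exact ⟨U₀, hU₀, hUaxis, hgrad⟩

/-- The field equations where `U` is constant. -/
theorem reduced_field_equations {R E : ℝ} {U a k μ : ℝ → ℝ → ℝ}
    {U₁ U₂ U₁₁ U₁₂ U₂₂ a₁ a₂ a₁₁ a₁₂ a₂₂ k₁ k₂ k₁₁ k₁₂ k₂₂ : ℝ → ℝ → ℝ}
    (cU : C2PartialsOn (square R) (fun r z => U |r| z) U₁ U₂ U₁₁ U₁₂ U₂₂)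
    (ca : C2PartialsOn (square R) (fun r z => a |r| z) a₁ a₂ a₁₁ a₁₂ a₂₂)
    (ck : C2PartialsOn (square R) (fun r z => k |r| z) k₁ k₂ k₁₁ k₁₂ k₂₂)
    (hEin : ∀ q ∈ halfSquare R,
      EinsteinEquationsAt (weylMetric U a k) (dustStress U μ) ![0, q.1, q.2, 0])
    (hEH : ∀ q ∈ halfSquare R, Real.exp (2 * U q.1 q.2) = E)
    (hgrad : ∀ q ∈ halfSquare R, U₁ q.1 q.2 = 0 ∧ U₂ q.1 q.2 = 0)
    {r z : ℝ} (hq : (r, z) ∈ halfSquare R) :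
    k₁ r z = -(E ^ 2 * (a₁ r z ^ 2 - a₂ r z ^ 2) / (4 * r)) ∧
      E ^ 2 / (2 * r ^ 2) * (a₁ r z ^ 2 + a₂ r z ^ 2)
        = 4 * Real.pi * μ r z * (Real.exp (2 * k r z) / E) ∧
      a₁₁ r z + a₂₂ r z - a₁ r z / r = 0 := by
  have hH := isOpen_halfSquare R
  have hsub := halfSquare_subset_square R
  have g3 := ((cU.first.mono hsub).unique hH (HasPartialsOn.zero _ 0)
    (fun q hq => (hgrad q hq).1) hq).1
  have g4 := ((cU.second.mono hsub).unique hH (HasPartialsOn.zero _ 0)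
    (fun q hq => (hgrad q hq).2) hq).2
  obtain ⟨g1, g2⟩ := hgrad _ hq
  have hEq := hEH _ hq
  obtain ⟨e1, -, e3, e4, -⟩ := field_equations (μ := μ) hH halfSquare_fst_ne_zero cU.zeroth.of_abs
    ca.zeroth.of_abs ck.zeroth.of_abs (cU.first.mono hsub) (cU.second.mono hsub)
    (ca.first.mono hsub) (ca.second.mono hsub) (ck.first.mono hsub) (ck.second.mono hsub) hq
    (hEin (r, z) hq)
  simp only at g1 g2 g3 g4 hEq
  rw [g1, g2, hEq] at e1
  rw [g1, g3, g4, hEq] at e3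
  rw [g1, g2] at e4
  refine ⟨?_, ?_, ?_⟩
  · rw [e1]; ring
  · rw [← e3]; ring
  · rw [← e4]; ring

/-- The norm `ρ²/E - E a²` tends to `-E a(0, z)²` at the axis. -/
theorem stream_axis_eq_zero {R E : ℝ} (hR : 0 < R) (hE0 : E ≠ 0) {U a k : ℝ → ℝ → ℝ}
    (ca : ContinuousOn (fun q : ℝ × ℝ => a |q.1| q.2) (square R))
    (hEH : ∀ q ∈ halfSquare R, Real.exp (2 * U q.1 q.2) = E) {z : ℝ} (hz : z ∈ Set.Ioo (-R) R)
    (hX : Filter.Tendsto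
      (fun r => axialNorm (weylMetric U a k) ![0, r, z, 0]) (𝓝[>] 0) (𝓝 0)) : a 0 z = 0 := by
  have h1 := tendsto_axis (f := fun r z => a |r| z) ca hz
  simp only [abs_zero] at h1
  have h2 : Filter.Tendsto (fun r : ℝ => r ^ 2 / E) (𝓝[>] 0) (𝓝 (0 ^ 2 / E)) :=
    tendsto_nhdsWithin_of_tendsto_nhds (by
      have : Continuous fun r : ℝ => r ^ 2 / E := by fun_prop
      exact this.tendsto 0)
  have h3 := h2.sub ((h1.pow 2).const_mul E)
  have h4 := tendsto_nhds_unique (hX) (h3.congr' (by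
    filter_upwards [Ioo_mem_nhdsGT hR] with r hr
    rw [axialNorm_weylMetric (p := ![0, r, z, 0]) (hEH (r, z) ⟨hr, hz⟩), abs_of_pos hr.1]
    rfl))
  have h5 : E * a 0 z ^ 2 = 0 := by
    rw [zero_pow two_ne_zero, zero_div] at h4
    linarith
  exact pow_eq_zero_iff two_ne_zero |>.1 ((mul_eq_zero.1 h5).resolve_left hE0)

theorem tendsto_div_axis {R : ℝ} {w w₁ w₂ : ℝ → ℝ → ℝ} (hw : HasPartialsOn (square R) w w₁ w₂)
    {z : ℝ} (hz : z ∈ Set.Ioo (-R) R) (hw0 : w 0 z = 0) :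
    Filter.Tendsto (fun r => w r z / r) (𝓝[>] 0) (𝓝 (w₁ 0 z)) := by
  have h0R : (0 : ℝ) ∈ Set.Ioo (-R) R := by constructor <;> linarith [hz.1, hz.2]
  have h1 := (hw.fst (0, z) ⟨h0R, hz⟩).tendsto_slope_zero_right
  refine h1.congr fun r => ?_
  simp [hw0, div_eq_inv_mul]

theorem tendsto_exp_axis {R : ℝ} {k : ℝ → ℝ → ℝ}
    (ck : ContinuousOn (fun q : ℝ × ℝ => k |q.1| q.2) (square R)) {z : ℝ}
    (hz : z ∈ Set.Ioo (-R) R) :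
    Filter.Tendsto (fun r => Real.exp (2 * k |r| z)) (𝓝[>] 0) (𝓝 (Real.exp (2 * k 0 z))) := by
  have h1 := tendsto_axis (f := fun r z => k |r| z) ck hz
  simp only [abs_zero] at h1
  exact (Real.continuous_exp.tendsto _).comp (h1.const_mul 2)

theorem snd_axis_eq_zero {R : ℝ} {w w₁ w₂ : ℝ → ℝ → ℝ} (hw : HasPartialsOn (square R) w w₁ w₂)
    (hw0 : ∀ z ∈ Set.Ioo (-R) R, w 0 z = 0) {z : ℝ} (hz : z ∈ Set.Ioo (-R) R) : w₂ 0 z = 0 := by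
  have h0R : (0 : ℝ) ∈ Set.Ioo (-R) R := by constructor <;> linarith [hz.1, hz.2]
  refine (hw.snd (0, z) ⟨h0R, hz⟩).unique ((hasDerivAt_const z (0 : ℝ)).congr_of_eventuallyEq ?_)
  filter_upwards [Ioo_mem_nhds hz.1 hz.2] with y hy using hw0 y hy

/-- Elementary flatness gives `k = 0` on the axis. -/
theorem k_axis_eq_zero {R E : ℝ} (hR : 0 < R) (hE0 : E ≠ 0) {U a k : ℝ → ℝ → ℝ}
    {U₁ U₂ U₁₁ U₁₂ U₂₂ a₁ a₂ a₁₁ a₁₂ a₂₂ k₁ k₂ k₁₁ k₁₂ k₂₂ : ℝ → ℝ → ℝ}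
    (cU : C2PartialsOn (square R) (fun r z => U |r| z) U₁ U₂ U₁₁ U₁₂ U₂₂)
    (ca : C2PartialsOn (square R) (fun r z => a |r| z) a₁ a₂ a₁₁ a₁₂ a₂₂)
    (ck : C2PartialsOn (square R) (fun r z => k |r| z) k₁ k₂ k₁₁ k₁₂ k₂₂)
    (hEH : ∀ q ∈ halfSquare R, Real.exp (2 * U q.1 q.2) = E)
    (hgrad : ∀ q ∈ halfSquare R, U₁ q.1 q.2 = 0 ∧ U₂ q.1 q.2 = 0)
    (haz : ∀ z ∈ Set.Ioo (-R) R, a 0 z = 0) {z : ℝ} (hz : z ∈ Set.Ioo (-R) R)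
    (hflat : Filter.Tendsto
      (fun r => gradSq (weylMetric U a k) (axialNorm (weylMetric U a k)) ![0, r, z, 0]
        / (4 * axialNorm (weylMetric U a k) ![0, r, z, 0])) (𝓝[>] 0) (𝓝 1)) : k 0 z = 0 := by
  have ha1 : a₁ 0 z = 0 := ca.fst_axis (fun r z => by simp only [abs_neg]) hz
  have ha2 : a₂ 0 z = 0 := snd_axis_eq_zero ca.zeroth (fun z hz => by simpa using haz z hz) hz
  have hs := tendsto_div_axis ca.zeroth hz (by simpa using haz z hz)
  rw [ha1] at hs
  have hexpk := tendsto_exp_axis ck.cont hz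
  have t1 := (tendsto_axis ca.cont₁ hz)
  have t2 := (tendsto_axis ca.cont₂ hz)
  rw [ha1] at t1
  rw [ha2] at t2
  -- Numerator and denominator of the flatness quotient are divided by `ρ²`. Since `a/ρ`, `a_ρ` and
  -- `a_ζ` tend to `0`, the quotient tends to `e^{-2k(0, z)}`.
  have hlim := (((hexpk).inv₀ (Real.exp_pos _).ne').const_mul E).mul
    (((((((hs).const_mul (2 * E)).mul t1).const_sub (2 / E)).pow 2).add
      ((((hs).const_mul (2 * E)).mul t2).pow 2)).div
      ((((hs).pow 2).const_mul E |>.const_sub (1 / E)).const_mul 4)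
      (by simp [hE0]))
  have h4 := tendsto_nhds_unique (hflat) (hlim.congr' (by
    filter_upwards [Ioo_mem_nhdsGT hR] with r hr
    have hr0 : r ≠ 0 := hr.1.ne'
    rw [axialNorm_weylMetric (p := ![0, r, z, 0]) (hEH (r, z) ⟨hr, hz⟩),
      gradSq_axialNorm cU.zeroth.of_abs ca.zeroth.of_abs ck.zeroth.of_abs (p := ![0, r, z, 0]) ⟨hr, hz⟩ hr0
        (hgrad (r, z) ⟨hr, hz⟩).1 (hgrad (r, z) ⟨hr, hz⟩).2 (hEH (r, z) ⟨hr, hz⟩) rfl,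
      abs_of_pos hr.1]
    simp only [Matrix.cons_val]
    have hK0 : Real.exp (2 * k r z) ≠ 0 := (Real.exp_pos _).ne'
    have e1 : (2 * r / E - 2 * E * a r z * a₁ r z) ^ 2 + (2 * E * a r z * a₂ r z) ^ 2
        = r ^ 2 * ((2 / E - 2 * E * (a r z / r) * a₁ r z) ^ 2
          + (2 * E * (a r z / r) * a₂ r z) ^ 2) := by
      field_simp
    have e2 : 4 * (r ^ 2 / E - E * a r z ^ 2)
        = r ^ 2 * (4 * (1 / E - E * (a r z / r) ^ 2)) := by
      field_simp
    rw [e1, e2, mul_left_comm, mul_div_mul_left _ _ (pow_ne_zero 2 hr0), mul_div_assoc,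
      div_eq_mul_inv E, Pi.div_apply, abs_of_pos hr.1]))
  have hK0 : Real.exp (2 * k 0 z) ≠ 0 := (Real.exp_pos _).ne'
  have h5 : Real.exp (2 * k 0 z) = 1 := by
    field_simp at h4
    linear_combination h4 / 4
  rw [Real.exp_eq_one_iff] at h5
  linarith

/-- The square of `a_{,ρρ}` on the axis in terms of the density. -/
theorem sq_stream_axis {R E : ℝ} (hR : 0 < R) (hE0 : E ≠ 0) {a k μ : ℝ → ℝ → ℝ}
    {a₁ a₂ a₁₁ a₁₂ a₂₂ : ℝ → ℝ → ℝ}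
    (ca : C2PartialsOn (square R) (fun r z => a |r| z) a₁ a₂ a₁₁ a₁₂ a₂₂)
    (ck : ContinuousOn (fun q : ℝ × ℝ => k |q.1| q.2) (square R))
    (cμ : ContinuousOn (fun q : ℝ × ℝ => μ |q.1| q.2) (square R))
    (haz : ∀ z ∈ Set.Ioo (-R) R, a 0 z = 0)
    (hFE : ∀ q ∈ halfSquare R, E ^ 2 / (2 * q.1 ^ 2) * (a₁ q.1 q.2 ^ 2 + a₂ q.1 q.2 ^ 2)
        = 4 * Real.pi * μ q.1 q.2 * (Real.exp (2 * k q.1 q.2) / E))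
    {z : ℝ} (hz : z ∈ Set.Ioo (-R) R) (hkz : k 0 z = 0) :
    E ^ 2 * a₁₁ 0 z ^ 2 = 8 * Real.pi * μ 0 z / E := by
  have ha1 : ∀ z ∈ Set.Ioo (-R) R, a₁ 0 z = 0 := fun z hz =>
    ca.fst_axis (fun r z => by simp only [abs_neg]) hz
  have ha2 : a₂ 0 z = 0 := snd_axis_eq_zero ca.zeroth (fun z hz => by simpa using haz z hz) hz
  have hs1 := tendsto_div_axis ca.first hz (ha1 z hz)
  have hs2 := tendsto_div_axis ca.second hz ha2
  rw [snd_axis_eq_zero ca.first ha1 hz] at hs2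
  have t1 := tendsto_axis (f := fun r z => μ |r| z) cμ hz
  simp only [abs_zero] at t1
  have t2 := tendsto_exp_axis ck hz
  rw [hkz, mul_zero, Real.exp_zero] at t2
  -- The density equation contains `a_ρ/ρ` and `a_ζ/ρ`, whose limits at the axis are `a_ρρ` and
  -- `a_ρζ = 0`.
  have hl := ((((hs1).pow 2).add ((hs2).pow 2)).const_mul (E ^ 2))
  have hr := ((t1.const_mul (8 * Real.pi)).mul t2).div_const E
  have := tendsto_nhds_unique hl (hr.congr' (by
    filter_upwards [Ioo_mem_nhdsGT hR] with r hr
    have hr0 : r ≠ 0 := hr.1.ne'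
    have e3 := hFE (r, z) ⟨hr, hz⟩
    rw [abs_of_pos hr.1]
    have : E ^ 2 * ((a₁ r z / r) ^ 2 + (a₂ r z / r) ^ 2)
        = 2 * (E ^ 2 / (2 * r ^ 2) * (a₁ r z ^ 2 + a₂ r z ^ 2)) := by
      field_simp
    rw [this, e3]
    ring))
  simpa using this

/-- The stream function `a` is determined by the density on the axis. -/
theorem stream_eq_of_axis {R E μ₀ : ℝ} (hR : 0 < R) (hE0 : E ≠ 0) (hμ₀ : μ₀ ≠ 0)
    {a a₁ a₂ a₁₁ a₁₂ a₂₂ : ℝ → ℝ → ℝ}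
    (ca : C2PartialsOn (square R) (fun r z => a |r| z) a₁ a₂ a₁₁ a₁₂ a₂₂)
    (haz : ∀ z ∈ Set.Ioo (-R) R, a 0 z = 0)
    (hpde : ∀ q ∈ halfSquare R, a₁₁ q.1 q.2 + a₂₂ q.1 q.2 - a₁ q.1 q.2 / q.1 = 0)
    (hsq : ∀ z ∈ Set.Ioo (-R) R, E ^ 2 * a₁₁ 0 z ^ 2 = 8 * Real.pi * μ₀ / E) :
    ∃ κ, E ^ 2 * κ ^ 2 = 8 * Real.pi * μ₀ / E ∧
      ∀ q ∈ halfSquare R, a q.1 q.2 = κ * q.1 ^ 2 / 2 := by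
  have h0R : (0 : ℝ) ∈ Set.Ioo (-R) R := ⟨by linarith, hR⟩
  have heven : ∀ r z, (fun r z => a |r| z) (-r) z = (fun r z => a |r| z) r z := fun r z => by
    simp only [abs_neg]
  set κ := a₁₁ 0 0 with hκ
  have hκsq : E ^ 2 * κ ^ 2 = 8 * Real.pi * μ₀ / E := hsq 0 h0R
  have hκ0 : κ ≠ 0 := by
    intro h0
    rw [h0, zero_pow two_ne_zero, mul_zero] at hκsq
    have hpi := Real.pi_pos
    exact (by positivity : 8 * Real.pi * μ₀ / E ≠ 0) hκsq.symm
  -- A continuous function on an interval with constant nonzero square cannot change sign.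
  have hκz : ∀ z ∈ Set.Ioo (-R) R, a₁₁ 0 z = κ := by
    have hc : ContinuousOn (fun z => a₁₁ 0 z) (Set.Ioo (-R) R) :=
      ca.cont₁₁.comp (f := fun z : ℝ => ((0 : ℝ), z)) (by fun_prop) fun z hz => ⟨h0R, hz⟩
    refine (isPreconnected_Ioo).eq_of_sq_eq hc (continuousOn_const (c := κ)) ?_ ?_ h0R rfl
    · intro z hz
      have := (hsq z hz).trans hκsq.symm
      exact mul_left_cancel₀ (pow_ne_zero 2 hE0) this
    · intro _ _; exact hκ0
  have hlin : ∀ x : ℝ, HasDerivAt (fun r : ℝ => κ * r) κ x := fun x => by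
    simpa using (hasDerivAt_id x).const_mul κ
  have hquad : ∀ x : ℝ, HasDerivAt (fun r : ℝ => κ * r ^ 2 / 2) (κ * x) x := fun x =>
    (((hasDerivAt_id' x).fun_pow 2).const_mul κ |>.div_const 2).congr_deriv (by push_cast; ring)
  -- `κ ρ² / 2` solves the stream equation and has the same axis values of `a`, `a_ρ` and `a_ρρ`.
  have hzero := eq_zero_of_stream_equation (R := R) (f := fun r z => a |r| z - κ * r ^ 2 / 2)
    (f₁ := fun r z => a₁ r z - κ * r) (f₂ := a₂) (f₁₁ := fun r z => a₁₁ r z - κ) (f₁₂ := a₁₂)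
    (f₂₂ := a₂₂)
    ⟨fun q hq => (ca.zeroth.fst q hq).sub (hquad q.1), fun q hq =>
      (ca.zeroth.snd q hq).sub_const _⟩
    ⟨fun q hq => (ca.first.fst q hq).sub (hlin q.1), fun q hq =>
      (ca.first.snd q hq).sub_const _⟩ ca.second
    (ca.cont.sub (by fun_prop)) (ca.cont₁.sub (by fun_prop)) ca.cont₂
    (ca.cont₁₁.sub (by fun_prop)) ca.cont₁₂ ca.cont₂₂
    (fun z hz => by simp [haz z hz])
    (fun z hz => by simp [ca.fst_axis heven hz])
    (fun z hz => by simp [hκz z hz])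
    -- For `x < 0` the equation follows by reflection: `a_ρ / ρ` is even, like `a_ρρ` and `a_ζζ`.
    (fun q hq hne => by
      rcases lt_or_gt_of_ne hne with hneg | hpos
      · obtain ⟨o1, -, o3, o4⟩ := ca.even_odd heven hq
        have := hpde (-q.1, q.2) ⟨⟨by linarith, (neg_mem_square hq).1.2⟩, hq.2⟩
        simp only at this
        rw [o1, o3, o4, neg_div_neg_eq] at this
        field_simp at this ⊢
        linarith
      · have := hpde q ⟨⟨hpos, hq.1.2⟩, hq.2⟩
        field_simp at this ⊢
        linarith)
  refine ⟨κ, hκsq, fun q hq => ?_⟩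
  have := hzero q (halfSquare_subset_square R hq) hq.1.1
  simp only [abs_of_pos hq.1.1] at this
  linarith

/-- The solution of the dust equations in the meridional half-plane near the axis. -/
theorem dust_near_axis {R μ₀ : ℝ} (hR : 0 < R) (hμ₀ : μ₀ ≠ 0) {U a k μ : ℝ → ℝ → ℝ}
    {U₁ U₂ U₁₁ U₁₂ U₂₂ a₁ a₂ a₁₁ a₁₂ a₂₂ k₁ k₂ k₁₁ k₁₂ k₂₂ : ℝ → ℝ → ℝ}
    (cU : C2PartialsOn (square R) (fun r z => U |r| z) U₁ U₂ U₁₁ U₁₂ U₂₂)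
    (ca : C2PartialsOn (square R) (fun r z => a |r| z) a₁ a₂ a₁₁ a₁₂ a₂₂)
    (ck : C2PartialsOn (square R) (fun r z => k |r| z) k₁ k₂ k₁₁ k₁₂ k₂₂)
    (cμ : ContinuousOn (fun q : ℝ × ℝ => μ |q.1| q.2) (square R))
    (hμ : ∀ q ∈ halfSquare R, μ q.1 q.2 ≠ 0)
    (hEin : ∀ q ∈ halfSquare R,
      EinsteinEquationsAt (weylMetric U a k) (dustStress U μ) ![0, q.1, q.2, 0])
    (hX : ∀ z ∈ Set.Ioo (-R) R, Filter.Tendsto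
      (fun r => axialNorm (weylMetric U a k) ![0, r, z, 0]) (𝓝[>] 0) (𝓝 0))
    (hflat : ∀ z ∈ Set.Ioo (-R) R, Filter.Tendsto
      (fun r => gradSq (weylMetric U a k) (axialNorm (weylMetric U a k)) ![0, r, z, 0]
        / (4 * axialNorm (weylMetric U a k) ![0, r, z, 0])) (𝓝[>] 0) (𝓝 1))
    (haxis : ∀ z ∈ Set.Ioo (-R) R, μ 0 z = μ₀) :
    ∃ U₀ κ : ℝ, (κ * Real.exp (4 * U₀)) ^ 2 = 8 * Real.pi * Real.exp (2 * U₀) * μ₀ ∧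
      ∀ r ∈ Set.Ico 0 R, ∀ z ∈ Set.Ioo (-R) R, U r z = U₀ ∧ a r z = κ * r ^ 2 / 2 ∧
        k r z = -(Real.pi * μ₀ * Real.exp (-2 * U₀) * r ^ 2) ∧
        μ r z = μ₀ * Real.exp (2 * Real.pi * μ₀ * Real.exp (-2 * U₀) * r ^ 2) := by
  obtain ⟨U₀, hU, hUaxis, hgrad⟩ := const_U_of_dust hR cU ca ck hμ hEin
  have hE0 : Real.exp (2 * U₀) ≠ 0 := (Real.exp_pos _).ne'
  have hEH : ∀ q ∈ halfSquare R, Real.exp (2 * U q.1 q.2) = Real.exp (2 * U₀) :=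
    fun q hq => by rw [hU q hq]
  have hFE := fun q (hq : q ∈ halfSquare R) =>
    reduced_field_equations (r := q.1) (z := q.2) cU ca ck hEin hEH hgrad hq
  have haz : ∀ z ∈ Set.Ioo (-R) R, a 0 z = 0 := fun z hz =>
    stream_axis_eq_zero hR hE0 ca.cont hEH hz (hX z hz)
  have hkz : ∀ z ∈ Set.Ioo (-R) R, k 0 z = 0 := fun z hz =>
    k_axis_eq_zero hR hE0 cU ca ck hEH hgrad haz hz (hflat z hz)
  obtain ⟨κ, hκ, ha⟩ := stream_eq_of_axis hR hE0 hμ₀ ca haz (fun q hq => (hFE q hq).2.2)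
    (fun z hz => by
      rw [sq_stream_axis hR hE0 ca ck.cont cμ haz (fun q hq => (hFE q hq).2.1) hz (hkz z hz),
        haxis z hz])
  have hE4 : Real.exp (4 * U₀) = Real.exp (2 * U₀) ^ 2 := by
    rw [← Real.exp_nat_mul]; push_cast; ring_nf
  have hEneg : Real.exp (-2 * U₀) = (Real.exp (2 * U₀))⁻¹ := exp_neg_two_mul U₀
  refine ⟨U₀, κ, ?_⟩
  rw [hE4, hEneg]
  generalize Real.exp (2 * U₀) = E at *
  have hκ' : E ^ 3 * κ ^ 2 = 8 * Real.pi * μ₀ := by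
    field_simp at hκ
    linarith
  have hquad : HasPartialsOn (halfSquare R) (fun r _ => κ * r ^ 2 / 2) (fun r _ => κ * r)
      (fun _ _ => 0) :=
    ⟨fun q _ => (((hasDerivAt_id' q.1).fun_pow 2).const_mul κ |>.div_const 2).congr_deriv
      (by push_cast; ring), fun q _ => hasDerivAt_const _ _⟩
  have ha' := fun q (hq : q ∈ halfSquare R) =>
    ca.zeroth.of_abs.unique (isOpen_halfSquare R) hquad ha hq
  -- With `a = κρ²/2` the equation for `k_ρ` reads `k_ρ = -2π μ₀ ρ / E`; the constant of integration
  -- is fixed by `k = 0` on the axis.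
  have hk : ∀ q ∈ halfSquare R, k q.1 q.2 = -(Real.pi * μ₀ * E⁻¹ * q.1 ^ 2) := by
    intro q hq
    have hconst : ∀ r ∈ Set.Ioo 0 R, HasDerivAt
        (fun r => k r q.2 + Real.pi * μ₀ * E⁻¹ * r ^ 2) 0 r := by
      intro r hr
      have hrq : (r, q.2) ∈ halfSquare R := ⟨hr, hq.2⟩
      have hr0 : r ≠ 0 := hr.1.ne'
      refine ((ck.zeroth.of_abs.fst (r, q.2) hrq).fun_add
        (((hasDerivAt_id' r).fun_pow 2).const_mul (Real.pi * μ₀ * E⁻¹))).congr_deriv ?_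
      rw [(hFE _ hrq).1, (ha' _ hrq).1, (ha' _ hrq).2]
      push_cast
      field_simp
      linear_combination -r ^ 2 * hκ'
    have hlim : Filter.Tendsto (fun r => k |r| q.2 + Real.pi * μ₀ * E⁻¹ * r ^ 2) (𝓝[>] 0)
        (𝓝 (k |0| q.2 + Real.pi * μ₀ * E⁻¹ * 0 ^ 2)) := by
      refine (tendsto_axis (f := fun r z => k |r| z) ck.cont hq.2).add
        (tendsto_nhdsWithin_of_tendsto_nhds ?_)
      exact (by fun_prop : Continuous fun r : ℝ => Real.pi * μ₀ * E⁻¹ * r ^ 2).tendsto 0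
    have huniq := tendsto_nhds_unique hlim (tendsto_const_nhds.congr' (by
      filter_upwards [Ioo_mem_nhdsGT hR] with r hr
      rw [abs_of_pos hr.1]
      exact eq_of_hasDerivAt_zero hconst hq.1 hr))
    rw [abs_zero, hkz _ hq.2] at huniq
    linarith
  refine ⟨?_, fun r hr z hz => ?_⟩
  · linear_combination E * hκ'
  rcases hr.1.eq_or_lt with rfl | hpos
  · simp [hUaxis z hz, haz z hz, hkz z hz, haxis z hz]
  have hq : (r, z) ∈ halfSquare R := ⟨⟨hpos, hr.2⟩, hz⟩
  refine ⟨hU _ hq, ha _ hq, hk _ hq, ?_⟩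
  have h1 := (hFE _ hq).2.1
  rw [(ha' _ hq).1, (ha' _ hq).2, hk _ hq] at h1
  -- The left side of the density equation is now constant, so `μ e^{2k}` equals its axis value
  -- `μ₀`.
  have h2 : μ r z * Real.exp (2 * -(Real.pi * μ₀ * E⁻¹ * r ^ 2)) = μ₀ := by
    have hpi := Real.pi_pos.ne'
    have h3 : E ^ 2 / (2 * r ^ 2) * ((κ * r) ^ 2 + 0 ^ 2) = 4 * Real.pi * (μ₀ / E) := by
      field_simp
      linear_combination r ^ 2 * hκ'
    rw [h3] at h1
    field_simp at h1 ⊢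
    linarith
  rw [show 2 * -(Real.pi * μ₀ * E⁻¹ * r ^ 2) = -(2 * Real.pi * μ₀ * E⁻¹ * r ^ 2) by ring,
    Real.exp_neg] at h2
  exact (mul_inv_eq_iff_eq_mul₀ (Real.exp_pos _).ne').1 h2

/-! ### Potentials of the stream function -/

theorem rho_sq_add_zeta_sq (x : Space) : rho x ^ 2 + zeta x ^ 2 = ‖x‖ ^ 2 := by
  rw [rho, zeta, Real.sq_sqrt (by positivity), EuclideanSpace.norm_sq_eq]
  simp [Fin.sum_univ_three]

theorem rho_zeta_of_mem_ball {R : ℝ} {x : Space} (hx : x ∈ Metric.ball (0 : Space) R) :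
    rho x ^ 2 + zeta x ^ 2 < R ^ 2 ∧ rho x ∈ Set.Ico 0 R ∧ zeta x ∈ Set.Ioo (-R) R := by
  rw [mem_ball_zero_iff] at hx
  have h := rho_sq_add_zeta_sq x
  have h0 : 0 ≤ rho x := Real.sqrt_nonneg _
  have hlt : ‖x‖ ^ 2 < R ^ 2 := pow_lt_pow_left₀ hx (norm_nonneg _) two_ne_zero
  have hR : 0 < R := (norm_nonneg _).trans_lt hx
  refine ⟨by linarith, ⟨h0, ?_⟩, abs_lt.1 ?_⟩
  · exact lt_of_pow_lt_pow_left₀ 2 hR.le (by nlinarith [sq_nonneg (zeta x)])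
  · exact lt_of_pow_lt_pow_left₀ 2 hR.le (by rw [sq_abs]; nlinarith [sq_nonneg (rho x)])

theorem axial_zero (f : ℝ → ℝ → ℝ) : axial f 0 = f 0 0 := by
  simp [axial, rho, zeta]

section Potential

variable {R U₀ κ : ℝ} {U a : ℝ → ℝ → ℝ}

theorem stream_derivs (ha : ∀ r ∈ Set.Ico 0 R, ∀ z ∈ Set.Ioo (-R) R, a r z = κ * r ^ 2 / 2)
    {r z : ℝ} (hr : r ∈ Set.Ioo 0 R) (hz : z ∈ Set.Ioo (-R) R) :
    deriv (fun r => a r z) r = κ * r ∧ deriv (fun z => a r z) z = 0 := by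
  constructor
  · have h : HasDerivAt (fun r => κ * r ^ 2 / 2) (κ * r) r :=
      ((((hasDerivAt_id' r).fun_pow 2).const_mul κ).div_const 2).congr_deriv (by push_cast; ring)
    refine (h.congr_of_eventuallyEq ?_).deriv
    filter_upwards [Ioo_mem_nhds hr.1 hr.2] with s hs using ha s ⟨hs.1.le, hs.2⟩ z hz
  · refine ((hasDerivAt_const z (κ * r ^ 2 / 2)).congr_of_eventuallyEq ?_).deriv
    filter_upwards [Ioo_mem_nhds hz.1 hz.2] with s hs using ha r ⟨hr.1.le, hr.2⟩ s hs

theorem isPotential_linear (hU : ∀ x ∈ Metric.ball (0 : Space) R, axial U x = U₀)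
    (ha : ∀ r ∈ Set.Ico 0 R, ∀ z ∈ Set.Ioo (-R) R, a r z = κ * r ^ 2 / 2) :
    IsPotential (Metric.ball 0 R) U a (fun _ z => κ * Real.exp (4 * U₀) * z) := by
  refine ⟨?_, fun x hx hρ => ?_, fun x hx hρ => ?_⟩
  · have : axial (fun _ z => κ * Real.exp (4 * U₀) * z)
        = fun x : Space => κ * Real.exp (4 * U₀) * x 2 := rfl
    rw [this]
    fun_prop
  · obtain ⟨-, h1, h2⟩ := rho_zeta_of_mem_ball hx
    rw [(stream_derivs ha ⟨hρ, h1.2⟩ h2).2]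
    simp
  · obtain ⟨-, h1, h2⟩ := rho_zeta_of_mem_ball hx
    rw [(stream_derivs ha ⟨hρ, h1.2⟩ h2).1, hU x hx, mul_div_cancel_right₀ _ hρ.ne']
    simp

/-- Off the axis `b_ρ = 0` and `b_ζ = κ e^{4U₀}`. The axis itself, and with it `b(0, 0)`, is reached
only through continuity of `b`. -/
theorem IsPotential.eq_linear (hR : 0 < R)
    (hU : ∀ x ∈ Metric.ball (0 : Space) R, axial U x = U₀)
    (ha : ∀ r ∈ Set.Ico 0 R, ∀ z ∈ Set.Ioo (-R) R, a r z = κ * r ^ 2 / 2)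
    {b : ℝ → ℝ → ℝ} (hb : IsPotential (Metric.ball 0 R) U a b) {x : Space}
    (hx : x ∈ Metric.ball (0 : Space) R) :
    axial b x = axial b 0 + κ * Real.exp (4 * U₀) * zeta x := by
  set D : Set (ℝ × ℝ) := {q | q.1 ^ 2 + q.2 ^ 2 < R ^ 2} with hD
  have hDo : IsOpen D := isOpen_lt (by fun_prop) continuous_const
  have hmem : ∀ q ∈ D, (!₂[q.1, 0, q.2] : Space) ∈ Metric.ball 0 R := fun q hq =>
    (meridional_mem_ball_iff hR).2 hq
  obtain ⟨b₁, b₂, _, _, _, cb⟩ := exists_c2PartialsOn (f := fun r z => b |r| z) hDo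
    (contDiffOn_meridional hb.contDiff hmem)
  have hder : ∀ q ∈ D, 0 < q.1 → b₁ q.1 q.2 = 0 ∧ b₂ q.1 q.2 = κ * Real.exp (4 * U₀) := by
    rintro ⟨r, z⟩ hq hr
    have hρ : rho !₂[r, 0, z] = r := by rw [rho_meridional, abs_of_pos hr]
    have hζ : zeta !₂[r, 0, z] = z := by simp [zeta]
    have hball := hmem _ hq
    obtain ⟨-, h1, h2⟩ := rho_zeta_of_mem_ball hball
    have d1 := hb.deriv_rho _ hball (by rw [hρ]; exact hr)
    have d2 := hb.deriv_zeta _ hball (by rw [hρ]; exact hr)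
    rw [hU _ hball] at d2
    simp only [hρ, hζ] at d1 d2 h1 h2
    obtain ⟨s1, s2⟩ := stream_derivs ha ⟨hr, h1.2⟩ h2
    rw [s2] at d1
    rw [s1, mul_div_cancel_right₀ _ hr.ne'] at d2
    have e1 : HasDerivAt (fun s => b s z) (b₁ r z) r := by
      refine (cb.zeroth.fst (r, z) hq).congr_of_eventuallyEq ?_
      filter_upwards [Ioi_mem_nhds hr] with s hs
      rw [abs_of_pos hs]
    have e2 : HasDerivAt (fun s => b r s) (b₂ r z) z := by
      have := cb.zeroth.snd (r, z) hq
      rwa [abs_of_pos hr] at this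
    rw [e1.deriv] at d1
    rw [e2.deriv] at d2
    exact ⟨by simpa using d1, d2⟩
  have hlim : ∀ z, (0, z) ∈ D →
      Filter.Tendsto (fun r => b |r| z) (𝓝[>] 0) (𝓝 (b 0 z)) := by
    intro z hz
    have h1 := (cb.cont.continuousAt (hDo.mem_nhds hz)).tendsto.comp
      (by fun_prop : ContinuousAt (fun r : ℝ => (r, z)) 0).tendsto
    simpa [Function.comp_def] using tendsto_nhdsWithin_of_tendsto_nhds (s := Set.Ioi 0) h1
  obtain ⟨hball, hr, hz⟩ := rho_zeta_of_mem_ball hx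
  set r := rho x
  set z := zeta x
  have h0z : (0, z) ∈ D := by
    simp only [hD, Set.mem_ofPred_eq]
    nlinarith [sq_nonneg r]
  have h00 : ((0 : ℝ), (0 : ℝ)) ∈ D := by
    change (0 : ℝ) ^ 2 + 0 ^ 2 < R ^ 2
    nlinarith [pow_pos hR 2]
  have hradial : b r z = b 0 z := by
    rcases hr.1.eq_or_lt with h0 | hpos
    · rw [← h0]
    have hwithin : ∀ s ∈ Set.Ioc 0 r, (s, z) ∈ D := fun s hs => by
      simp only [hD, Set.mem_ofPred_eq]
      nlinarith [hs.1, hs.2]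
    refine tendsto_nhds_unique (tendsto_const_nhds.congr' ?_) (hlim z h0z)
    filter_upwards [Ioo_mem_nhdsGT hpos] with s hs
    have := Convex.norm_image_sub_le_of_norm_hasDerivWithin_le (f := fun s => b |s| z)
      (f' := fun s => b₁ s z) (C := 0) (s := Set.Ioc 0 r)
      (fun t ht => (cb.zeroth.fst (t, z) (hwithin t ht)).hasDerivWithinAt)
      (fun t ht => by simp [(hder (t, z) (hwithin t ht) ht.1).1]) (convex_Ioc 0 r)
      ⟨hs.1, hs.2.le⟩ ⟨hpos, le_rfl⟩
    rw [zero_mul, norm_le_zero_iff, sub_eq_zero] at this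
    simpa only [abs_of_pos hpos] using this
  -- The increment is computed on the parallel line `ρ = s`, where the derivative is known, and `s`
  -- tends to `0`.
  have hvert : b 0 z - b 0 0 = κ * Real.exp (4 * U₀) * z := by
    refine tendsto_nhds_unique ((hlim z h0z).sub (hlim 0 h00)) (tendsto_const_nhds.congr' ?_)
    have hev : ∀ᶠ s in 𝓝[>] (0 : ℝ), (s, z) ∈ D :=
      (tendsto_nhdsWithin_of_tendsto_nhds
        (by fun_prop : ContinuousAt (fun s : ℝ => (s, z)) 0).tendsto).eventually
        (hDo.mem_nhds h0z)
    filter_upwards [hev, self_mem_nhdsWithin] with s hs hpos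
    have hwithin : ∀ t ∈ Set.uIcc 0 z, (s, t) ∈ D := fun t ht => by
      have h1 : |t| ≤ |z| := by simpa using Set.abs_sub_left_of_mem_uIcc ht
      have h2 := sq_le_sq.2 h1
      simp only [hD, Set.mem_ofPred_eq] at hs ⊢
      linarith
    have := Convex.norm_image_sub_le_of_norm_hasDerivWithin_le
      (f := fun t => b |s| t - κ * Real.exp (4 * U₀) * t)
      (f' := fun t => b₂ s t - κ * Real.exp (4 * U₀) * 1) (C := 0) (s := Set.uIcc 0 z)
      (fun t ht => ((cb.zeroth.snd (s, t) (hwithin t ht)).sub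
        ((hasDerivAt_id t).const_mul _)).hasDerivWithinAt)
      (fun t ht => by simp [(hder (s, t) (hwithin t ht) hpos).2]) (convex_uIcc 0 z)
      Set.left_mem_uIcc Set.right_mem_uIcc
    rw [zero_mul, norm_le_zero_iff, sub_eq_zero] at this
    linarith
  rw [axial_zero]
  change b r z = _
  linarith

end Potential

/-! ### Assembly: the dust near the origin and the main theorem -/

theorem place_meridional (t r z : ℝ) : place ![t, r, z, 0] = !₂[r, 0, z] := by
  simp [place]

theorem tendsto_meridional {F : (Fin 4 → ℝ) → ℝ} {z l : ℝ}
    (h : Filter.Tendsto (fun q : ℝ × ℝ => F ![0, q.1, q.2, 0]) (𝓝[>] 0 ×ˢ 𝓝 z) (𝓝 l)) :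
    Filter.Tendsto (fun r => F ![0, r, z, 0]) (𝓝[>] 0) (𝓝 l) :=
  h.comp (Filter.tendsto_id.prodMk tendsto_const_nhds : Filter.Tendsto (fun r : ℝ => (r, z))
    (𝓝[>] 0) (𝓝[>] 0 ×ˢ 𝓝 z))

/-- Near the origin a rigidly rotating dust with constant density on the axis is the Lanczos
solution. -/
theorem exists_lanczos {Ω : Set Space} {U a k μ : ℝ → ℝ → ℝ}
    (hdust : IsRigidlyRotatingDust Ω U a k μ) (hreg : RegularityAssumptions Ω U a k μ)
    (haxis : AxisAssumptions Ω U a k) {μ₀ : ℝ} (hμ₀ : μ₀ ≠ 0)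
    (hμ : ∀ x ∈ axisIn Ω, axial μ x = μ₀) :
    ∃ R U₀ κ : ℝ, 0 < R ∧ Metric.ball (0 : Space) R ⊆ Ω ∧
      (κ * Real.exp (4 * U₀)) ^ 2 = 8 * Real.pi * Real.exp (2 * U₀) * μ₀ ∧
      ∀ r ∈ Set.Ico 0 R, ∀ z ∈ Set.Ioo (-R) R, U r z = U₀ ∧ a r z = κ * r ^ 2 / 2 ∧
        k r z = -(Real.pi * μ₀ * Real.exp (-2 * U₀) * r ^ 2) ∧
        μ r z = μ₀ * Real.exp (2 * Real.pi * μ₀ * Real.exp (-2 * U₀) * r ^ 2) := by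
  obtain ⟨ε, hε, hball⟩ := Metric.isOpen_iff.1 hdust.isOpen 0 haxis.origin_mem.1
  -- The meridional square of half-side `R` fits into the ball of radius `2R`.
  obtain ⟨R, rfl⟩ : ∃ R, ε = 2 * R := ⟨ε / 2, by ring⟩
  have hR : 0 < R := by linarith
  have hΩ : ∀ q ∈ square R, (!₂[q.1, 0, q.2] : Space) ∈ Ω := fun q hq =>
    hball (meridional_mem_ball hq)
  obtain ⟨U₁, U₂, U₁₁, U₁₂, U₂₂, cU⟩ := exists_c2PartialsOn (f := fun r z => U |r| z)
    (isOpen_square R) (contDiffOn_meridional hreg.contDiff_U hΩ)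
  obtain ⟨a₁, a₂, a₁₁, a₁₂, a₂₂, ca⟩ := exists_c2PartialsOn (f := fun r z => a |r| z)
    (isOpen_square R) (contDiffOn_meridional hreg.contDiff_a hΩ)
  obtain ⟨k₁, k₂, k₁₁, k₁₂, k₂₂, ck⟩ := exists_c2PartialsOn (f := fun r z => k |r| z)
    (isOpen_square R) (contDiffOn_meridional hreg.contDiff_k hΩ)
  have cμ : ContinuousOn (fun q : ℝ × ℝ => μ |q.1| q.2) (square R) :=
    (hdust.density_continuous.comp contDiff_meridional.continuous.continuousOn hΩ).congr
      fun q _ => (axial_meridional μ q.1 q.2).symm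
  have hax : ∀ z ∈ Set.Ioo (-R) R, (!₂[0, 0, z] : Space) ∈ axisIn Ω := fun z hz =>
    ⟨hΩ (0, z) ⟨⟨by linarith, hR⟩, hz⟩, by simp [rho_meridional]⟩
  have hX : ∀ z ∈ Set.Ioo (-R) R, Filter.Tendsto
      (fun r => axialNorm (weylMetric U a k) ![0, r, z, 0]) (𝓝[>] 0) (𝓝 0) := fun z hz =>
    tendsto_meridional (F := axialNorm (weylMetric U a k)) (haxis.flat _ (hax z hz) 0 0).1
  have hflat : ∀ z ∈ Set.Ioo (-R) R, Filter.Tendsto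
      (fun r => gradSq (weylMetric U a k) (axialNorm (weylMetric U a k)) ![0, r, z, 0]
        / (4 * axialNorm (weylMetric U a k) ![0, r, z, 0])) (𝓝[>] 0) (𝓝 1) := fun z hz =>
    tendsto_meridional (F := fun p => gradSq (weylMetric U a k) (axialNorm (weylMetric U a k)) p
      / (4 * axialNorm (weylMetric U a k) p)) (haxis.flat _ (hax z hz) 0 0).2
  have hne : ∀ q ∈ halfSquare R, μ q.1 q.2 ≠ 0 := fun q hq => by
    have := hreg.density_ne_zero _ (hΩ q (halfSquare_subset_square R hq))
    rwa [axial_meridional, abs_of_pos hq.1.1] at this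
  have hEin : ∀ q ∈ halfSquare R,
      EinsteinEquationsAt (weylMetric U a k) (dustStress U μ) ![0, q.1, q.2, 0] := fun q hq => by
    refine hdust.einstein_eq _ hq.1.1 ?_
    rw [place_meridional]
    exact hΩ q (halfSquare_subset_square R hq)
  have hμaxis : ∀ z ∈ Set.Ioo (-R) R, μ 0 z = μ₀ := fun z hz => by
    have := hμ _ (hax z hz)
    rwa [axial_meridional, abs_zero] at this
  obtain ⟨U₀, κ, hκ, hsol⟩ := dust_near_axis hR hμ₀ cU ca ck cμ hne hEin hX hflat hμaxis
  exact ⟨R, U₀, κ, hR, (Metric.ball_subset_ball (by linarith)).trans hball, hκ, hsol⟩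

end Dust

end

theorem corollary1 (Ω : Set Dust.Space) (U a k μ : ℝ → ℝ → ℝ)
    (hdust : Dust.IsRigidlyRotatingDust Ω U a k μ)
    (hreg : Dust.RegularityAssumptions Ω U a k μ)
    (haxis : Dust.AxisAssumptions Ω U a k) :
    (∀ μ₀ : ℝ, μ₀ ≠ 0 → (∀ x ∈ Dust.axisIn Ω, Dust.axial μ x = μ₀) →
      ∃ σ : ℝ, 0 < σ ∧ Metric.ball (0 : Dust.Space) σ ⊆ Ω ∧
        ∃ U₀ : ℝ, (∀ x ∈ Metric.ball (0 : Dust.Space) σ, Dust.axial U x = U₀) ∧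
        (∃ b : ℝ → ℝ → ℝ, Dust.IsPotential (Metric.ball 0 σ) U a b) ∧
        (∃ s : ℝ, (s = 1 ∨ s = -1) ∧
          ∀ b : ℝ → ℝ → ℝ, Dust.IsPotential (Metric.ball 0 σ) U a b →
            ∀ x ∈ Metric.ball (0 : Dust.Space) σ,
              Dust.axial b x = Dust.axial b 0
                + s * Real.sqrt (8 * Real.pi * Real.exp (2 * U₀) * μ₀) * Dust.zeta x) ∧
        (∀ x ∈ Metric.ball (0 : Dust.Space) σ,
          Dust.axial k x = -(Real.pi * μ₀ * Real.exp (-2 * U₀) * Dust.rho x ^ 2)) ∧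
        (∀ x ∈ Metric.ball (0 : Dust.Space) σ,
          Dust.axial μ x
            = μ₀ * Real.exp (2 * Real.pi * μ₀ * Real.exp (-2 * U₀) * Dust.rho x ^ 2))) ∧
    ¬ ∃ μ₀ : ℝ, ∀ x ∈ Ω, Dust.axial μ x = μ₀ := by
  constructor
  · intro μ₀ hμ₀ hμ
    obtain ⟨R, U₀, κ, hR, hball, hκ, hsol⟩ := Dust.exists_lanczos hdust hreg haxis hμ₀ hμ
    have hx : ∀ x ∈ Metric.ball (0 : Dust.Space) R, _ := fun x hx =>
      hsol _ (Dust.rho_zeta_of_mem_ball hx).2.1 _ (Dust.rho_zeta_of_mem_ball hx).2.2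
    have hU : ∀ x ∈ Metric.ball (0 : Dust.Space) R, Dust.axial U x = U₀ := fun x h => (hx x h).1
    have ha := fun r hr z hz => (hsol r hr z hz).2.1
    refine ⟨R, hR, hball, U₀, hU, ⟨_, Dust.isPotential_linear hU ha⟩, ?_,
      fun x h => (hx x h).2.2.1, fun x h => (hx x h).2.2.2⟩
    -- The root is `|κ e^{4U₀}|`. The sign is that of `κ`, which is determined by `a` alone and so
    -- is shared by all potentials.
    rw [← hκ, Real.sqrt_sq_eq_abs]
    rcases le_total 0 (κ * Real.exp (4 * U₀)) with hs | hs
    · refine ⟨1, Or.inl rfl, fun b hb x h => ?_⟩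
      rw [abs_of_nonneg hs, one_mul]
      exact hb.eq_linear hR hU ha h
    · refine ⟨-1, Or.inr rfl, fun b hb x h => ?_⟩
      rw [abs_of_nonpos hs, neg_one_mul, neg_neg]
      exact hb.eq_linear hR hU ha h
  · rintro ⟨μ₀, hμ⟩
    have h0 := haxis.origin_mem.1
    have hμ₀ : μ₀ ≠ 0 := hμ 0 h0 ▸ hreg.density_ne_zero 0 h0
    obtain ⟨R, U₀, κ, hR, hball, -, hsol⟩ :=
      Dust.exists_lanczos hdust hreg haxis hμ₀ fun x hx => hμ x hx.1
    -- Any point of the ball off the axis would do: the exponent of the Lanczos density is nonzero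
    -- there, so `μ ≠ μ₀`.
    have hmem : (!₂[R / 2, 0, 0] : Dust.Space) ∈ Metric.ball 0 R :=
      (Dust.meridional_mem_ball_iff hR).2 (by nlinarith)
    have h1 := hμ _ (hball hmem)
    rw [Dust.axial_meridional, abs_of_pos (by positivity),
      (hsol (R / 2) ⟨by positivity, by linarith⟩ 0 ⟨by linarith, hR⟩).2.2.2,
      mul_eq_left₀ hμ₀, Real.exp_eq_one_iff] at h1
    have := Real.pi_pos
    exact (by positivity :
      2 * Real.pi * μ₀ * Real.exp (-2 * U₀) * (R / 2) ^ 2 ≠ 0) h1
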